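/- Generalized hyperreal categoricity theorem. Work in ZFC. The generalized continuum hypothesis (GCH) is the assertion that $2^\kappa=\kappa^+$ for every infinite cardinal $\kappa$. A structure $M$ is $\kappa$-saturated if, for every $A\subseteq M$ with $|A|<\kappa$, every set of first-order formulas in one free variable with parameters from $A$ that is finitely satisfiable in $M$ is realized in $M$; and $M$ is saturated if it is $|M|$-saturated. Real-closed fields are regarded as structures in the language of rings (in which their order is definable). (1) The GCH holds if and only if, for every uncountable regular cardinal $\kappa$, there is a saturated real-closed field of cardinality $\kappa$ and any two saturated real-closed fields of cardinality $\kappa$ are isomorphic. (2) For every uncountable cardinal $\kappa$, if there is a saturated real-closed field of cardinality $\kappa$, then $\kappa^{<\kappa}=\kappa$. -/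

import Mathlib

open scoped Cardinal

universe u

/-- The generalized continuum hypothesis: `2 ^ κ = κ⁺` for every infinite cardinal `κ`. -/
def GCH : Prop :=
  ∀ κ : Cardinal.{u}, ℵ₀ ≤ κ → (2 : Cardinal.{u}) ^ κ = Order.succ κ

/-- A structure `M` is `κ`-saturated if, for every set `A` of fewer than `κ` parameters from `M`,
every set `p` of first-order formulas in one free variable with parameters from `A` which is
finitely satisfiable in `M` is realized by a single element of `M`. A formula with parameters
from `A` is a formula whose free variables are the parameters `a : A` (interpreted as themselves)
and the one genuine variable `Sum.inr ()`. -/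
def IsKappaSaturated (L : FirstOrder.Language.{0, 0}) (M : Type u) [L.Structure M]
    (κ : Cardinal.{u}) : Prop :=
  ∀ A : Set M, #A < κ → ∀ p : Set (L.Formula (A ⊕ Unit)),
    (∀ q : Set (L.Formula (A ⊕ Unit)), q ⊆ p → q.Finite →
      ∃ x : M, ∀ φ ∈ q, φ.Realize (Sum.elim (fun a : A => (a : M)) (fun _ => x))) →
    ∃ x : M, ∀ φ ∈ p, φ.Realize (Sum.elim (fun a : A => (a : M)) (fun _ => x))

/-- A structure is saturated if it is `κ`-saturated where `κ` is its own cardinality. -/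
def IsSaturated (L : FirstOrder.Language.{0, 0}) (M : Type u) [L.Structure M] : Prop :=
  IsKappaSaturated L M #M

/-- The field `F` is a saturated real-closed field: it is real closed and it is saturated as a
structure in the language of rings, whose symbols are interpreted by the field operations. (The
order of a real-closed field is definable in that language: `x ≤ y` iff `y - x` is a square.) -/
def IsSaturatedRealClosedField (F : Type u) [Field F] : Prop :=
  IsRealClosed F ∧
    @IsSaturated FirstOrder.Language.ring F (FirstOrder.Ring.compatibleRingOfRing F).toStructure

/-!
The theorem rests on three facts.

*Saturated real closed fields are large.* The order of a saturated real closed field `F` is an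
`η`-set: every cut defined by fewer than `#F` elements is filled, since it is a type over a small
set of parameters (`IsSaturatedRealClosedField.isEtaOrder`). In particular no set of fewer than
`#F` elements is cofinal, and so `#F` is regular (`IsEtaOrder.isRegular`). Moreover the sequences
of signs of length `c < #F` label the nodes of a tree of cuts in `F`, and distinct sequences lead
to distinct elements, so that `2 ^ c ≤ #F` (`IsEtaOrder.two_power_le`). For a regular cardinal
this means `#F ^< #F = #F`, which is the second part of the theorem; at successor cardinals
`κ = c⁺` it says `2 ^ c ≤ c⁺`, and so existence at all uncountable regular cardinals implies GCH
(`gch_of_powerlt_self`).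

*Saturated models exist if `κ ^< κ = κ`*, as it holds under GCH for every regular `κ`. A name is a
set of formulas in one free variable whose parameters, fewer than `κ` of them, are replaced by
names; there are at most `κ` names. Well-order the names such that each comes after its
parameters, and accept the requirements of a name if they are consistent with those accepted
before. By compactness there is a model of the theory with an assignment of the names that meets
all accepted requirements. The range of the assignment realizes every type over fewer than `κ` of
its elements that is finitely satisfiable in the model; by the Tarski–Vaught test it is an
elementary substructure, and it is saturated
(`FirstOrder.Language.Theory.exists_saturated_model`).

*Saturated real closed fields of the same regular cardinality are isomorphic.* An isomorphism of
ordered subrings of `F` and `K` is treated as its graph, a subring of `F × K` on which the two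
coordinates have the same sign. A maximal such subring within the product of two relatively
algebraically closed subfields contains, in both coordinates, all roots of polynomials over it
(`Subring.Concordant.roots_mem_of_maximal`): by Rolle's theorem a root of a polynomial of minimal
degree that is missing on one side is isolated by the roots of the derivative, which are present,
and by the intermediate value theorem there is a corresponding root on the other side
(`exists_root_of_cut`). Over such a subring the sign of `q x` is determined by the cut of `x`, as
one sees by splitting off the roots of `q` (`eval₂_pos_iff_of_cut`), and the `η`-set `K` contains
an element with the corresponding cut. A back-and-forth construction of length `κ` follows
(`nonempty_ringEquiv_of_isEtaOrder`). The intermediate value theorem holds because irreducible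
polynomials over a real closed field have degree at most two
(`IsRealClosed.natDegree_le_two_of_irreducible`). -/

/-! ### Real closed fields: the order, and polynomials of degree at most two -/

namespace IsRealClosed

open Polynomial

variable {R : Type*} [Field R]

/-- If `-(x² + y²)` were a square `z²` with `x ≠ 0`, then dividing by `x²` would give
`1 + (y / x)² + (z / x)² = 0`. -/
theorem isSquare_add [IsRealClosed R] {a b : R} (ha : IsSquare a) (hb : IsSquare b) :
    IsSquare (a + b) := by
  obtain ⟨x, rfl⟩ := ha
  obtain ⟨y, rfl⟩ := hb
  rcases isSquare_or_isSquare_neg (x * x + y * y) with h | ⟨z, hz⟩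
  · exact h
  by_cases hx : x = 0
  · subst hx
    exact ⟨y, by ring⟩
  refine absurd ?_ (IsSemireal.one_add_ne_zero (R := R) (s := (y / x) * (y / x) + (z / x) * (z / x))
    ((IsSumSq.mul_self _).add (IsSumSq.mul_self _)))
  field_simp
  linear_combination -hz

theorem eq_zero_of_isSquare_of_isSquare_neg [IsRealClosed R] {a : R} (ha : IsSquare a)
    (hb : IsSquare (-a)) : a = 0 := by
  obtain ⟨x, rfl⟩ := ha
  obtain ⟨y, hy⟩ := hb
  by_contra hx
  have hx : x ≠ 0 := fun h => hx (by simp [h])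
  refine IsSemireal.one_add_ne_zero (R := R) (s := (y / x) * (y / x)) (IsSumSq.mul_self _) ?_
  field_simp
  linear_combination -hy

/-- The order of a real closed field: `x ≤ y` if and only if `y - x` is a square. -/
@[reducible]
noncomputable def linearOrder (R : Type*) [Field R] [IsRealClosed R] : LinearOrder R where
  le x y := IsSquare (y - x)
  le_refl x := ⟨0, by ring⟩
  le_trans x y z h h' := by
    have := isSquare_add h h'
    rwa [show y - x + (z - y) = z - x by ring] at this
  le_antisymm x y h h' := by
    have := eq_zero_of_isSquare_of_isSquare_neg h (by rwa [neg_sub])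
    exact (sub_eq_zero.1 this).symm
  le_total x y := by
    rcases isSquare_or_isSquare_neg (y - x) with h | h
    · exact Or.inl h
    · exact Or.inr (by rwa [neg_sub] at h)
  toDecidableLE := Classical.decRel _

theorem isStrictOrderedRing (R : Type*) [Field R] [IsRealClosed R] :
    letI := linearOrder R
    IsStrictOrderedRing R := by
  let := linearOrder R
  have hle : ∀ x y : R, x ≤ y ↔ IsSquare (y - x) := fun _ _ => Iff.rfl
  have : IsOrderedAddMonoid R :=
    { add_le_add_left := fun a b h c => by
        rw [hle] at h ⊢
        rwa [add_sub_add_right_eq_sub] }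
  have : ZeroLEOneClass R := ⟨by rw [hle]; exact ⟨1, by ring⟩⟩
  have : IsOrderedRing R := IsOrderedRing.of_mul_nonneg fun x y hx hy => by
    rw [hle, sub_zero] at *
    exact hx.mul hy
  exact IsOrderedRing.toIsStrictOrderedRing R

variable [LinearOrder R] [IsStrictOrderedRing R]

/-- The minimal polynomial of a primitive element has odd degree, so it has a root and is linear. -/
theorem finrank_eq_one_of_odd [IsRealClosed R] {L : Type*} [Field L] [Algebra R L]
    [FiniteDimensional R L] (h : Odd (Module.finrank R L)) : Module.finrank R L = 1 := by
  obtain ⟨α, hα⟩ := Field.exists_primitive_element R L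
  have hint : IsIntegral R α := .of_finite R α
  have hdeg : (minpoly R α).natDegree = Module.finrank R L := by
    rw [← IntermediateField.adjoin.finrank hint, hα, IntermediateField.finrank_top']
  rw [← hdeg] at h ⊢
  obtain ⟨x, hx⟩ := exists_isRoot_of_odd_natDegree h
  exact natDegree_eq_of_degree_eq_some
    (degree_eq_one_of_irreducible_of_root (minpoly.irreducible hint) hx)

/-- The fixed field of a subgroup of index two of the Galois group, which is a `2`-group. -/
theorem _root_.IsGalois.exists_intermediateField_finrank_eq_two {K N : Type*} [Field K] [Field N]
    [Algebra K N] [FiniteDimensional K N] [IsGalois K N] {m : ℕ}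
    (h : Module.finrank K N = 2 ^ (m + 1)) :
    ∃ E : IntermediateField K N, Module.finrank K E = 2 := by
  have : Fact (Nat.Prime 2) := ⟨Nat.prime_two⟩
  have hc := IsGalois.card_aut_eq_finrank K N
  obtain ⟨H, hH⟩ := Sylow.exists_subgroup_card_pow_prime (G := N ≃ₐ[K] N) 2 (n := m)
    (by rw [hc, h]; exact pow_dvd_pow _ (Nat.le_succ m))
  refine ⟨IntermediateField.fixedField H, ?_⟩
  have h1 := IntermediateField.finrank_fixedField_eq_card H
  have h2 := Module.finrank_mul_finrank K (IntermediateField.fixedField H) N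
  rw [h1, hH, h, pow_succ, mul_comm] at h2
  exact Nat.eq_of_mul_eq_mul_left (by positivity) h2

/-- A quadratic extension in characteristic zero is generated by the square root of a non-square:
complete the square. -/
theorem _root_.exists_sq_eq_algebraMap_of_finrank_eq_two {K E : Type*} [Field K] [Field E]
    [CharZero K] [Algebra K E] (h : Module.finrank K E = 2) :
    ∃ (d : K) (s : E), ¬ IsSquare d ∧ s * s = algebraMap K E d ∧
      ∀ z : E, ∃ a b : K, z = algebraMap K E a + algebraMap K E b * s := by
  have : FiniteDimensional K E := Module.finite_of_finrank_eq_succ h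
  have : CharZero E := charZero_of_injective_algebraMap (algebraMap K E).injective
  obtain ⟨α, hα⟩ : ∃ α : E, α ∉ (algebraMap K E).range := by
    by_contra! hcon
    have : (⊥ : Subalgebra K E) = ⊤ := by
      refine eq_top_iff.2 fun x _ => ?_
      obtain ⟨y, hy⟩ := hcon x
      exact Algebra.mem_bot.2 ⟨y, hy⟩
    have h1 := Subalgebra.bot_eq_top_iff_finrank_eq_one.1 this
    omega
  have hli : LinearIndependent K ![1, α] := by
    rw [LinearIndependent.pair_iff]
    intro s t hst
    have ht : t = 0 := by
      by_contra ht
      refine hα ⟨-s / t, ?_⟩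
      have ht' : algebraMap K E t ≠ 0 := by simpa using ht
      rw [Algebra.smul_def, Algebra.smul_def] at hst
      rw [map_div₀, map_neg, div_eq_iff ht']
      linear_combination -hst
    subst ht
    simpa using hst
  have hspan : ⊤ ≤ Submodule.span K (Set.range ![1, α]) :=
    (hli.span_eq_top_of_card_eq_finrank' (by simp [h])).ge
  have hrep : ∀ z : E, ∃ a b : K, z = algebraMap K E a + algebraMap K E b * α := by
    intro z
    have hz := hspan (Submodule.mem_top (x := z))
    simp only [Matrix.range_cons, Matrix.range_empty, Set.union_empty, Set.singleton_union] at hz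
    obtain ⟨a, b, hab⟩ := Submodule.mem_span_pair.1 hz
    exact ⟨a, b, by rw [← hab, Algebra.smul_def, Algebra.smul_def, mul_one]⟩
  obtain ⟨c, b, hcb⟩ := hrep (α * α)
  have hs : (α - algebraMap K E (b / 2)) * (α - algebraMap K E (b / 2)) =
      algebraMap K E (c + b * b / 4) := by
    simp only [map_div₀, map_add, map_mul, map_ofNat]
    linear_combination hcb
  refine ⟨c + b * b / 4, α - algebraMap K E (b / 2), ?_, hs, fun z => ?_⟩
  · rintro ⟨r, hr⟩
    rw [hr, map_mul, mul_self_eq_mul_self_iff] at hs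
    rcases hs with hs | hs
    · exact hα ⟨r + b / 2, by rw [map_add]; linear_combination -hs⟩
    · exact hα ⟨-r + b / 2, by rw [map_add, map_neg]; linear_combination -hs⟩
  · obtain ⟨x, y, hz⟩ := hrep z
    refine ⟨x + y * (b / 2), y, ?_⟩
    rw [hz, map_add, map_mul]
    ring

/-- Over a real closed field a quadratic extension contains a square root of `-1`, and all its
elements are squares, by the usual formula for the square root of a complex number. -/
theorem isSquare_of_finrank_eq_two [IsRealClosed R] {E : Type*} [Field E] [Algebra R E]
    (h : Module.finrank R E = 2) (z : E) : IsSquare z := by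
  obtain ⟨d, s, hd, hs, hrep⟩ := exists_sq_eq_algebraMap_of_finrank_eq_two h
  obtain ⟨e, he⟩ := isSquare_neg_of_not_isSquare hd
  obtain ⟨a, b, rfl⟩ := hrep z
  have hd' : d = -(e * e) := by linear_combination -he
  subst hd'
  -- `r` is the absolute value of `a + b * s`; its square root has the real and imaginary parts
  -- `√((r + a) / 2)` and `± √((r - a) / 2)`.
  obtain ⟨r, hr0, hr⟩ : ∃ r : R, 0 ≤ r ∧ r * r = a * a + (b * e) * (b * e) := by
    obtain ⟨r, hr⟩ := IsSquare.of_nonneg (R := R) (x := a * a + (b * e) * (b * e))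
      (add_nonneg (mul_self_nonneg a) (mul_self_nonneg _))
    exact ⟨|r|, abs_nonneg r, by rw [abs_mul_abs_self, hr]⟩
  have har : |a| ≤ r := abs_le_of_sq_le_sq (by nlinarith [mul_self_nonneg (b * e)]) hr0
  obtain ⟨h1, h2⟩ := abs_le.1 har
  obtain ⟨x, hx⟩ := IsSquare.of_nonneg (R := R) (x := (r + a) / 2) (by linarith)
  obtain ⟨y, hy⟩ := IsSquare.of_nonneg (R := R) (x := (r - a) / 2) (by linarith)
  have he0 : e ≠ 0 := by
    rintro rfl
    exact hd ⟨0, by simp⟩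
  have hxy : (2 * x * y) * (2 * x * y) = (b * e) * (b * e) := by
    have : (2 * x * y) * (2 * x * y) = 4 * (x * x) * (y * y) := by ring
    rw [this, ← hx, ← hy]
    linear_combination hr
  obtain ⟨t, ht1, ht2⟩ : ∃ t : R, t * t = y * y ∧ 2 * x * t = b * e := by
    rcases mul_self_eq_mul_self_iff.1 hxy with h | h
    · exact ⟨y, rfl, h⟩
    · exact ⟨-y, by ring, by linear_combination -h⟩
  have hb : b = 2 * x * (t / e) := by
    field_simp
    linear_combination -ht2
  have ha : a = x * x - t * t := by
    rw [ht1, ← hx, ← hy]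
    ring
  refine ⟨algebraMap R E x + algebraMap R E (t / e) * s, ?_⟩
  have ha' : a = x * x - (t / e) * (t / e) * (e * e) := by
    rw [ha]
    field_simp
  rw [hb, ha']
  simp only [map_sub, map_mul, map_neg] at hs ⊢
  have h2E : algebraMap R E 2 = 2 := map_ofNat _ 2
  rw [h2E]
  linear_combination -(algebraMap R E (t / e) * algebraMap R E (t / e)) * hs

/-- An irreducible polynomial over a real closed field has degree at most two: the Galois group of
its splitting field is a `2`-group, because there are no proper extensions of odd degree; and it
has at most two elements, because the elements of a quadratic extension are all squares. -/
theorem natDegree_le_two_of_irreducible [IsRealClosed R] {p : R[X]} (hp : Irreducible p) :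
    p.natDegree ≤ 2 := by
  have : Fact (Nat.Prime 2) := ⟨Nat.prime_two⟩
  have : IsGalois R p.SplittingField := IsGalois.of_separable_splitting_field (p := p) hp.separable
  -- The fixed field of a Sylow `2`-subgroup has odd degree over `R`, so it is `R`.
  obtain ⟨k, hk⟩ : ∃ k, Module.finrank R p.SplittingField = 2 ^ k := by
    obtain ⟨H, hH2, hH⟩ : ∃ H : Subgroup (p.SplittingField ≃ₐ[R] p.SplittingField),
        IsPGroup 2 H ∧ ¬ 2 ∣ H.index :=
      let S : Sylow 2 (p.SplittingField ≃ₐ[R] p.SplittingField) := default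
      ⟨S, S.isPGroup', S.not_dvd_index⟩
    have h1 := IntermediateField.finrank_fixedField_eq_card H
    have h2 := Module.finrank_mul_finrank R (IntermediateField.fixedField H) p.SplittingField
    have h3 := H.card_mul_index
    rw [IsGalois.card_aut_eq_finrank, ← h2, h1, mul_comm] at h3
    have h4 := Nat.eq_of_mul_eq_mul_right Nat.card_pos h3
    have h5 : Module.finrank R (IntermediateField.fixedField H) = 1 := by
      apply finrank_eq_one_of_odd
      rw [← h4]
      exact Nat.not_even_iff_odd.1 fun h => hH h.two_dvd
    obtain ⟨n, hn⟩ := IsPGroup.iff_card.1 hH2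
    exact ⟨n, by rw [← h2, h5, h1, one_mul, ← hn]⟩
  -- Otherwise there are quadratic extensions `R ⊂ Q ⊂ E`, but `Q` is closed under square roots.
  have hk1 : k ≤ 1 := by
    by_contra! hk1
    obtain ⟨m, rfl⟩ := Nat.exists_eq_add_of_le hk1
    rw [show Nat.succ 1 + m = (m + 1) + 1 by omega] at hk
    obtain ⟨Q, hQ⟩ := IsGalois.exists_intermediateField_finrank_eq_two hk
    have h2 := Module.finrank_mul_finrank R Q p.SplittingField
    rw [hQ, hk, pow_succ, mul_comm] at h2
    obtain ⟨E, hE⟩ := IsGalois.exists_intermediateField_finrank_eq_two (K := Q)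
      (Nat.eq_of_mul_eq_mul_right two_pos h2)
    obtain ⟨d, s, hd, -⟩ := exists_sq_eq_algebraMap_of_finrank_eq_two hE
    exact hd (isSquare_of_finrank_eq_two hQ d)
  have h2 : Module.finrank R p.SplittingField ≤ 2 := by
    rw [hk]
    exact (Nat.pow_le_pow_right two_pos hk1).trans (by norm_num)
  obtain ⟨α, hα⟩ := (SplittingField.splits p).exists_eval_eq_zero
    (by rw [degree_map]; exact (degree_pos_of_irreducible hp).ne')
  rw [eval_map_algebraMap] at hα
  have h3 := minpoly.natDegree_le (A := R) α
  rw [← minpoly.eq_of_irreducible hp hα, natDegree_mul_C (by simpa using hp.ne_zero)] at h3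
  exact h3.trans h2

end IsRealClosed

/-! ### Sign changes and roots of polynomials over a real closed field -/

namespace IsRealClosed

open Polynomial

variable {R : Type*} [Field R] [LinearOrder R] [IsStrictOrderedRing R] [IsRealClosed R]

/-- A polynomial of degree at most two without roots does not change sign: its discriminant is
negative. -/
theorem quadratic_mul_pos_of_no_root {α β γ : R} (h : ∀ x : R, α * x ^ 2 + β * x + γ ≠ 0)
    (a b : R) :
    0 < (α * a ^ 2 + β * a + γ) * (α * b ^ 2 + β * b + γ) := by
  by_cases hα : α = 0
  · subst hα
    by_cases hβ : β = 0
    · subst hβ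
      have := h 0
      simp only [zero_mul, zero_add] at this ⊢
      exact mul_self_pos.2 (by simpa using this)
    · exact absurd (by field_simp; ring) (h (-γ / β))
  have hd : β ^ 2 - 4 * α * γ < 0 := by
    by_contra! hd
    obtain ⟨s, hs⟩ := IsSquare.of_nonneg hd
    refine h ((s - β) / (2 * α)) ?_
    field_simp
    linear_combination -hs
  have key : ∀ x : R, 0 < 4 * α * (α * x ^ 2 + β * x + γ) := fun x => by
    have : 4 * α * (α * x ^ 2 + β * x + γ) = (2 * α * x + β) ^ 2 - (β ^ 2 - 4 * α * γ) := by ring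
    rw [this]
    have := sq_nonneg (2 * α * x + β)
    linarith
  have h1 := mul_pos (key a) (key b)
  have h2 : 0 < 16 * α ^ 2 := by positivity
  refine pos_of_mul_pos_right (a := 16 * α ^ 2) ?_ h2.le
  convert h1 using 1
  ring

/-- The intermediate value theorem for polynomials over a real closed field: one of the irreducible
factors changes sign, it has degree at most two, and so it is linear. -/
theorem exists_isRoot_of_eval_mul_eval_neg {f : R[X]} {a b : R} (hab : a < b)
    (h : f.eval a * f.eval b < 0) : ∃ c, a < c ∧ c < b ∧ f.eval c = 0 := by
  induction f using WfDvdMonoid.induction_on_irreducible with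
  | zero => simp at h
  | unit u hu =>
    obtain ⟨r, -, rfl⟩ := Polynomial.isUnit_iff.1 hu
    rw [eval_C, eval_C] at h
    exact absurd h (mul_self_nonneg r).not_gt
  | mul f p hf hp ih =>
    rw [eval_mul, eval_mul] at h
    have h' : (p.eval a * p.eval b) * (f.eval a * f.eval b) < 0 := by linarith
    by_cases hpab : p.eval a * p.eval b < 0
    · have h2 := natDegree_le_two_of_irreducible hp
      by_cases hroot : ∃ r, p.IsRoot r
      · obtain ⟨r, hr⟩ := hroot
        obtain ⟨q, rfl⟩ := dvd_iff_isRoot.2 hr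
        have hq := (hp.isUnit_or_isUnit rfl).resolve_left (not_isUnit_X_sub_C r)
        obtain ⟨c, -, rfl⟩ := Polynomial.isUnit_iff.1 hq
        simp only [eval_mul, eval_sub, eval_X, eval_C] at hpab
        have h3 : (a - r) * (b - r) < 0 := by
          by_contra! h3
          have := mul_nonneg (mul_self_nonneg c) h3
          linarith
        refine ⟨r, ?_, ?_, by simp⟩
        · by_contra! hra
          have := mul_nonneg (sub_nonneg.2 hra) (sub_nonneg.2 (hra.trans hab.le))
          linarith
        · by_contra! hra
          have := mul_nonneg_of_nonpos_of_nonpos (sub_nonpos.2 (hab.le.trans hra))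
            (sub_nonpos.2 hra)
          linarith
      · have hev : ∀ x, p.eval x = p.coeff 2 * x ^ 2 + p.coeff 1 * x + p.coeff 0 := fun x => by
          rw [eval_eq_sum_range' (Nat.lt_succ_of_le h2)]
          simp only [Finset.sum_range_succ, Finset.sum_range_zero]
          ring
        have := quadratic_mul_pos_of_no_root (α := p.coeff 2) (β := p.coeff 1) (γ := p.coeff 0)
          (fun x hx => hroot ⟨x, (hev x).trans hx⟩) a b
        rw [← hev, ← hev] at this
        exact absurd hpab this.not_gt
    · obtain ⟨c, hac, hcb, hc⟩ := ih (by
        by_contra! h4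
        exact absurd h' (mul_nonneg (not_lt.1 hpab) h4).not_gt)
      exact ⟨c, hac, hcb, by rw [eval_mul, hc, mul_zero]⟩

theorem eval_mul_eval_pos_of_no_root {f : R[X]} {a b : R}
    (h : ∀ c, a ≤ c → c ≤ b → f.eval c ≠ 0) (hab : a ≤ b) : 0 < f.eval a * f.eval b := by
  rcases hab.eq_or_lt with rfl | hab'
  · exact mul_self_pos.2 (h a le_rfl le_rfl)
  by_contra! hle
  rcases hle.lt_or_eq with hlt | heq
  · obtain ⟨c, h1, h2, h3⟩ := exists_isRoot_of_eval_mul_eval_neg hab' hlt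
    exact h c h1.le h2.le h3
  · rcases mul_eq_zero.1 heq with h1 | h1
    · exact h a le_rfl hab h1
    · exact h b hab le_rfl h1

/-- Rolle's theorem for polynomials over a real closed field. For consecutive roots `a < b` write
`f = (X - a) (X - b) q`; then `f'(a) = (a - b) q(a)` and `f'(b) = (b - a) q(b)`, while `q` does not
change sign between `a` and `b`. -/
theorem exists_isRoot_derivative {f : R[X]} {a b : R} (hab : a < b) (ha : f.eval a = 0)
    (hb : f.eval b = 0) : ∃ c, a ≤ c ∧ c ≤ b ∧ (derivative f).eval c = 0 := by
  classical
  by_cases hf : f = 0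
  · exact ⟨a, le_rfl, hab.le, by simp [hf]⟩
  by_contra! hcon
  -- `m` is the first root after `a`.
  let s : Finset R := f.roots.toFinset.filter fun c => a < c ∧ c ≤ b
  have hs : s.Nonempty := ⟨b, by simp [s, hf, hab, hb]⟩
  have hmem := s.min'_mem hs
  have hmin : ∀ c, f.eval c = 0 → a < c → c < s.min' hs → False := fun c hc hac hcb => by
    have hb' : s.min' hs ≤ b := s.min'_le b (by simp [s, hf, hab, hb])
    exact absurd (s.min'_le c (by simp [s, hf, hac, hc, (hcb.trans_le hb').le])) hcb.not_ge
  generalize s.min' hs = m at hmem hmin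
  simp only [s, Finset.mem_filter, Multiset.mem_toFinset, mem_roots hf, IsRoot.def] at hmem
  obtain ⟨hm0, ham, hmb⟩ := hmem
  obtain ⟨g, rfl⟩ := dvd_iff_isRoot.2 ha
  have hg : g.IsRoot m := by
    simpa [sub_ne_zero.2 ham.ne'] using hm0
  obtain ⟨q, rfl⟩ := dvd_iff_isRoot.2 hg
  have h1 := hcon a le_rfl hab.le
  have h2 := hcon m ham.le hmb
  have hlt : (derivative ((X - C a) * ((X - C m) * q))).eval a *
      (derivative ((X - C a) * ((X - C m) * q))).eval m < 0 := by
    have hne := mul_ne_zero h1 h2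
    refine lt_of_le_of_ne ?_ hne
    have hq : 0 ≤ q.eval a * q.eval m := by
      by_contra! hq
      obtain ⟨c, h3, h4, h5⟩ := exists_isRoot_of_eval_mul_eval_neg ham hq
      exact hmin c (by simp [h5]) h3 h4
    simp only [derivative_mul, derivative_sub, derivative_X, derivative_C, eval_add, eval_mul,
      eval_sub, eval_X, eval_C, eval_one, sub_self, sub_zero]
    have : 0 ≤ (m - a) * (m - a) * (q.eval a * q.eval m) := mul_nonneg (mul_self_nonneg _) hq
    linarith
  obtain ⟨c, h3, h4, h5⟩ := exists_isRoot_of_eval_mul_eval_neg ham hlt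
  exact hcon c h3.le (h4.le.trans hmb) h5

end IsRealClosed

/-! ### Cuts over a common subring of two real closed fields -/

section Cut

open Polynomial

variable {A F K : Type*} [CommRing A] [Field F] [LinearOrder F] [IsStrictOrderedRing F]
  [Field K] [LinearOrder K] [IsStrictOrderedRing K] {f : A →+* F} {g : A →+* K}

theorem map_eq_zero_iff_of_pos_iff (hfg : ∀ a, 0 < f a ↔ 0 < g a) (a : A) : f a = 0 ↔ g a = 0 := by
  have h1 := hfg a
  have h2 := hfg (-a)
  rw [map_neg, map_neg, neg_pos, neg_pos] at h2
  constructor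
  · intro h
    exact le_antisymm (not_lt.1 fun h' => (h1.2 h').ne' h) (not_lt.1 fun h' => (h2.2 h').ne h)
  · intro h
    exact le_antisymm (not_lt.1 fun h' => (h1.1 h').ne' h) (not_lt.1 fun h' => (h2.1 h').ne h)

theorem map_lt_map_iff_of_pos_iff (hfg : ∀ a, 0 < f a ↔ 0 < g a) (a b : A) :
    f a < f b ↔ g a < g b := by
  have := hfg (b - a)
  rwa [map_sub, map_sub, sub_pos, sub_pos] at this

theorem eval₂_pos_iff_of_no_root [IsRealClosed F] {k : A →+* F} {q : A[X]}
    (hne : ∀ z, q.eval₂ k z ≠ 0) (z : F) : 0 < q.eval₂ k z ↔ 0 < k (q.eval 0) := by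
  have h0 : k (q.eval 0) = (q.map k).eval 0 := by
    rw [eval_map, ← map_zero k, eval₂_at_apply]
  rw [h0, ← eval_map]
  have hne' : ∀ z, (q.map k).eval z ≠ 0 := fun z => by
    rw [eval_map]
    exact hne z
  rcases le_total z 0 with hz | hz
  · have := IsRealClosed.eval_mul_eval_pos_of_no_root (fun c _ _ => hne' c) hz
    exact ⟨fun h => (pos_iff_pos_of_mul_pos this).1 h, fun h => (pos_iff_pos_of_mul_pos this).2 h⟩
  · have := IsRealClosed.eval_mul_eval_pos_of_no_root (fun c _ _ => hne' c) hz
    exact ⟨fun h => (pos_iff_pos_of_mul_pos this).2 h, fun h => (pos_iff_pos_of_mul_pos this).1 h⟩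

/-- If `x` and `y` realize the same cut over a common ordered subring `A` of two real closed fields,
and if `A` contains all roots of the polynomial `q` in both fields, then `q x` and `q y` have the
same sign: divide out the linear factors of `q`, and note that a polynomial without roots does not
change sign. -/
theorem eval₂_pos_iff_of_cut [IsRealClosed F] [IsRealClosed K]
    (hf : Function.Injective f) (hfg : ∀ a, 0 < f a ↔ 0 < g a) {x : F} {y : K}
    (hx : x ∉ Set.range f) (hlt : ∀ a, f a < x → g a < y) (hgt : ∀ a, x < f a → y < g a)
    (n : ℕ) (hF : ∀ q : A[X], q ≠ 0 → q.natDegree ≤ n → ∀ z, q.eval₂ f z = 0 → z ∈ Set.range f)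
    (hK : ∀ q : A[X], q ≠ 0 → q.natDegree ≤ n → ∀ z, q.eval₂ g z = 0 → z ∈ Set.range g)
    (q : A[X]) (hq : q.natDegree ≤ n) : 0 < q.eval₂ f x ↔ 0 < q.eval₂ g y := by
  have hg : Function.Injective g := by
    rw [injective_iff_map_eq_zero] at hf ⊢
    exact fun a ha => hf a ((map_eq_zero_iff_of_pos_iff hfg a).2 ha)
  have : Nontrivial A := f.domain_nontrivial
  induction h : q.natDegree using Nat.strong_induction_on generalizing q with
  | _ m ih =>
  by_cases hq0 : q = 0
  · simp [hq0]
  by_cases hroot : ∃ a, q.IsRoot a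
  · obtain ⟨a, ha⟩ := hroot
    obtain ⟨r, rfl⟩ := dvd_iff_isRoot.2 ha
    have hr0 : r ≠ 0 := by
      rintro rfl
      simp at hq0
    have hdeg : ((X - C a) * r).natDegree = 1 + r.natDegree := by
      rw [(monic_X_sub_C a).natDegree_mul' hr0, natDegree_X_sub_C]
    have h1 := ih r.natDegree (by omega) r (by omega) rfl
    have h2 := ih r.natDegree (by omega) (-r) (by rw [natDegree_neg]; omega) (natDegree_neg r)
    rw [eval₂_neg, eval₂_neg, neg_pos, neg_pos] at h2
    simp only [eval₂_mul, eval₂_sub, eval₂_X, eval₂_C]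
    rcases lt_trichotomy (f a) x with hax | hax | hax
    · rw [mul_pos_iff_of_pos_left (sub_pos.2 hax), mul_pos_iff_of_pos_left (sub_pos.2 (hlt a hax))]
      exact h1
    · exact absurd ⟨a, hax⟩ hx
    · rw [← neg_mul_neg, ← neg_mul_neg (y - g a), neg_sub, neg_sub,
        mul_pos_iff_of_pos_left (sub_pos.2 hax), mul_pos_iff_of_pos_left (sub_pos.2 (hgt a hax)),
        neg_pos, neg_pos]
      exact h2
  · rw [eval₂_pos_iff_of_no_root (k := f) ?_ x, eval₂_pos_iff_of_no_root (k := g) ?_ y, hfg]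
    · intro z hz
      obtain ⟨a, rfl⟩ := hK q hq0 hq z hz
      rw [eval₂_at_apply] at hz
      exact hroot ⟨a, hg (hz.trans (map_zero g).symm)⟩
    · intro z hz
      obtain ⟨a, rfl⟩ := hF q hq0 hq z hz
      rw [eval₂_at_apply] at hz
      exact hroot ⟨a, hf (hz.trans (map_zero f).symm)⟩

/-- If `x` exceeds all elements of the subfield `A`, then a polynomial over `A` with positive
leading coefficient is positive at `x`, and even bounded below by a positive element of `A`. The
lower bound is what the induction along Horner's scheme needs. -/
theorem exists_pos_le_eval₂_of_forall_lt (hA : IsField A) {x : F} (hx : ∀ a, f a < x) (n : ℕ) :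
    ∀ q : A[X], q.natDegree ≤ n → 0 < f (q.coeff n) → ∃ δ, 0 < f δ ∧ f δ ≤ q.eval₂ f x := by
  induction n with
  | zero =>
    intro q hq hc
    refine ⟨q.coeff 0, hc, ?_⟩
    rw [eq_C_of_natDegree_le_zero hq]
    simp
  | succ n ih =>
    intro q hq hc
    obtain ⟨δ, hδ, hle⟩ := ih q.divX (by rw [natDegree_divX_eq_natDegree_tsub_one]; omega)
      (by rwa [coeff_divX])
    refine ⟨δ, hδ, ?_⟩
    obtain ⟨b, hb⟩ := hA.mul_inv_cancel (a := δ) (by rintro rfl; simp at hδ)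
    have h0 : f δ * f b = 1 := by rw [← map_mul, hb, map_one]
    have h1 : f (b * (δ - q.coeff 0)) < x := hx _
    have h2 : 0 < x := by simpa using hx 0
    conv_rhs => rw [← divX_mul_X_add q]
    rw [eval₂_add, eval₂_mul, eval₂_X, eval₂_C]
    have h3 := mul_le_mul_of_nonneg_right hle h2.le
    have h4 := mul_lt_mul_of_pos_left h1 hδ
    rw [map_mul, map_sub, ← mul_assoc, h0, one_mul] at h4
    linarith

/-- An element that is algebraic over a subfield does not exceed all of its elements. -/
theorem exists_lt_map_of_eval₂_eq_zero (hA : IsField A) {x : F} (hx : x ∉ Set.range f) {p : A[X]}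
    (hp : p ≠ 0) (hpx : p.eval₂ f x = 0) : ∃ a, x < f a := by
  let := hA.toField
  have hf := f.injective
  by_contra! hcon
  have hx' : ∀ a, f a < x := fun a => lt_of_le_of_ne (hcon a) fun h => hx ⟨a, h⟩
  have hc : f (p.coeff p.natDegree) ≠ 0 := by
    rw [Ne, map_eq_zero_iff f hf]
    exact leadingCoeff_ne_zero.2 hp
  rcases hc.lt_or_gt with h | h
  · obtain ⟨δ, h1, h2⟩ := exists_pos_le_eval₂_of_forall_lt hA hx' p.natDegree (-p)
      (natDegree_neg p).le (by simpa using h)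
    rw [eval₂_neg, hpx, neg_zero] at h2
    exact absurd h1 h2.not_gt
  · obtain ⟨δ, h1, h2⟩ := exists_pos_le_eval₂_of_forall_lt hA hx' p.natDegree p le_rfl h
    rw [hpx] at h2
    exact absurd h1 h2.not_gt

theorem exists_map_lt_of_eval₂_eq_zero (hA : IsField A) {x : F} (hx : x ∉ Set.range f) {p : A[X]}
    (hp : p ≠ 0) (hpx : p.eval₂ f x = 0) : ∃ a, f a < x := by
  obtain ⟨a, ha⟩ := exists_lt_map_of_eval₂_eq_zero (f := f) hA (x := -x) (p := p.comp (-X))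
    (fun ⟨a, ha⟩ => hx ⟨-a, by rw [map_neg, ha, neg_neg]⟩)
    (fun h => hp (by
      have := congrArg (fun q => q.comp (-X)) h
      simpa [comp_assoc] using this))
    (by rw [eval₂_comp]; simpa using hpx)
  exact ⟨-a, by rw [map_neg]; linarith⟩

/-- The point `u` is the largest root of `D` below `x`, or an arbitrary element of `A` below `x` if
this is larger or if there is no such root. -/
theorem exists_maximal_lower_root (hA : IsField A) {x : F} (hx : x ∉ Set.range f) {p : A[X]}
    (hp : p ≠ 0) (hpx : p.eval₂ f x = 0) {D : F[X]} (hD0 : D ≠ 0)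
    (hD : ∀ z, D.eval z = 0 → z ∈ Set.range f) :
    ∃ u, f u < x ∧ ∀ c, D.eval c = 0 → c < x → c ≤ f u := by
  classical
  obtain ⟨u₀, hu₀⟩ := exists_map_lt_of_eval₂_eq_zero hA hx hp hpx
  let s : Finset F := insert (f u₀) (D.roots.toFinset.filter fun c => c < x)
  have hs : s.Nonempty := Finset.insert_nonempty _ _
  have hall : ∀ c ∈ s, c < x ∧ c ∈ Set.range f := by
    intro c hc
    rcases Finset.mem_insert.1 hc with rfl | hc
    · exact ⟨hu₀, u₀, rfl⟩
    · simp only [Finset.mem_filter, Multiset.mem_toFinset, mem_roots hD0] at hc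
      exact ⟨hc.2, hD c hc.1⟩
  obtain ⟨h1, u, hu⟩ := hall _ (s.max'_mem hs)
  refine ⟨u, hu ▸ h1, fun c hc hcx => hu ▸ s.le_max' c ?_⟩
  simp [s, hD0, hc, hcx]

theorem exists_minimal_upper_root (hA : IsField A) {x : F} (hx : x ∉ Set.range f) {p : A[X]}
    (hp : p ≠ 0) (hpx : p.eval₂ f x = 0) {D : F[X]} (hD0 : D ≠ 0)
    (hD : ∀ z, D.eval z = 0 → z ∈ Set.range f) :
    ∃ v, x < f v ∧ ∀ c, D.eval c = 0 → x < c → f v ≤ c := by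
  classical
  obtain ⟨u₀, hu₀⟩ := exists_lt_map_of_eval₂_eq_zero hA hx hp hpx
  let s : Finset F := insert (f u₀) (D.roots.toFinset.filter fun c => x < c)
  have hs : s.Nonempty := Finset.insert_nonempty _ _
  have hall : ∀ c ∈ s, x < c ∧ c ∈ Set.range f := by
    intro c hc
    rcases Finset.mem_insert.1 hc with rfl | hc
    · exact ⟨hu₀, u₀, rfl⟩
    · simp only [Finset.mem_filter, Multiset.mem_toFinset, mem_roots hD0] at hc
      exact ⟨hc.2, hD c hc.1⟩
  obtain ⟨h1, u, hu⟩ := hall _ (s.min'_mem hs)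
  refine ⟨u, hu ▸ h1, fun c hc hcx => hu ▸ s.min'_le c ?_⟩
  simp [s, hD0, hc, hcx]

/-- Let `A` be a common ordered subfield of two real closed fields that contains all roots of
polynomials over `A` of degree at most `n`, and let `x` be a root in `F`, outside `A`, of a
polynomial `p` over `A` of degree `n + 1`. Then `p` has a root in `K` that realizes the same cut
over `A`. The derivative of `p` has its roots in `A`, so `x` lies in an interval with endpoints in
`A` on which Rolle's theorem allows at most one root of `p`, in either field. -/
theorem exists_root_of_cut [IsRealClosed F] [IsRealClosed K] (hA : IsField A)
    (hfg : ∀ a, 0 < f a ↔ 0 < g a) {x : F} (hx : x ∉ Set.range f)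
    (n : ℕ) (hF : ∀ q : A[X], q ≠ 0 → q.natDegree ≤ n → ∀ z, q.eval₂ f z = 0 → z ∈ Set.range f)
    (hK : ∀ q : A[X], q ≠ 0 → q.natDegree ≤ n → ∀ z, q.eval₂ g z = 0 → z ∈ Set.range g)
    {p : A[X]} (hp : p.natDegree = n + 1) (hpx : p.eval₂ f x = 0) :
    ∃ y : K, p.eval₂ g y = 0 ∧ (∀ a, f a < x → g a < y) ∧ (∀ a, x < f a → y < g a) := by
  let := hA.toField
  have hf := f.injective
  have hlt := map_lt_map_iff_of_pos_iff hfg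
  have hp0 : p ≠ 0 := by
    rintro rfl
    simp at hp
  have hnoroot : ∀ a, p.eval a ≠ 0 := by
    intro a ha
    obtain ⟨r, rfl⟩ := dvd_iff_isRoot.2 ha
    have hr0 : r ≠ 0 := by
      rintro rfl
      simp at hp0
    rw [(monic_X_sub_C a).natDegree_mul' hr0, natDegree_X_sub_C] at hp
    rw [eval₂_mul, mul_eq_zero, eval₂_sub, eval₂_X, eval₂_C, sub_eq_zero] at hpx
    rcases hpx with h | h
    · exact hx ⟨a, h.symm⟩
    · exact hx (hF r hr0 (by omega) x h)
  have hD0 : derivative (p.map f) ≠ 0 := by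
    intro h
    have := derivative_eq_zero.1 h
    rw [natDegree_map_eq_of_injective hf] at this
    omega
  have hD0' : derivative p ≠ 0 := by
    intro h
    rw [derivative_map, h, Polynomial.map_zero] at hD0
    exact hD0 rfl
  have hDn : (derivative p).natDegree ≤ n := by
    have := natDegree_derivative_le p
    omega
  have hDF : ∀ z, (derivative (p.map f)).eval z = 0 → z ∈ Set.range f := fun z hz => by
    rw [derivative_map, eval_map] at hz
    exact hF _ hD0' hDn z hz
  have hmapF : ∀ a, (p.map f).eval (f a) = f (p.eval a) := fun a => by
    rw [eval_map, eval₂_at_apply]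
  have hmapK : ∀ a, (p.map g).eval (g a) = g (p.eval a) := fun a => by
    rw [eval_map, eval₂_at_apply]
  obtain ⟨u, hux, hu⟩ := exists_maximal_lower_root hA hx hp0 hpx hD0 hDF
  obtain ⟨v, hxv, hv⟩ := exists_minimal_upper_root hA hx hp0 hpx hD0 hDF
  have hDuv : ∀ c, f u < c → c < f v → (derivative (p.map f)).eval c ≠ 0 := by
    intro c h1 h2 hc
    rcases lt_trichotomy c x with h | h | h
    · exact absurd (hu c hc h) h1.not_ge
    · exact hx (h ▸ hDF c hc)
    · exact absurd (hv c hc h) h2.not_ge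
  have hDuvK : ∀ c, g u < c → c < g v → (derivative (p.map g)).eval c ≠ 0 := by
    intro c h1 h2 hc
    rw [derivative_map, eval_map] at hc
    obtain ⟨a, rfl⟩ := hK _ hD0' hDn c hc
    refine hDuv (f a) ((hlt _ _).2 h1) ((hlt _ _).2 h2) ?_
    rw [derivative_map, eval_map, eval₂_at_apply]
    rw [eval₂_at_apply] at hc
    exact (map_eq_zero_iff_of_pos_iff hfg _).2 hc
  have huniqF : ∀ s t, f u < s → s < t → t < f v → (p.map f).eval s = 0 → (p.map f).eval t = 0 →
      False := fun s t h1 h2 h3 h4 h5 => by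
    obtain ⟨c, h6, h7, h8⟩ := IsRealClosed.exists_isRoot_derivative h2 h4 h5
    exact hDuv c (h1.trans_le h6) (h7.trans_lt h3) h8
  have huniqK : ∀ s t, g u < s → s < g v → g u < t → t < g v → (p.map g).eval s = 0 →
      (p.map g).eval t = 0 → s = t := fun s t h1 h2 h3 h4 h5 h6 => by
    rcases lt_trichotomy s t with h | h | h
    · obtain ⟨c, h7, h8, h9⟩ := IsRealClosed.exists_isRoot_derivative h h5 h6
      exact absurd h9 (hDuvK c (h1.trans_le h7) (h8.trans_lt h4))
    · exact h
    · obtain ⟨c, h7, h8, h9⟩ := IsRealClosed.exists_isRoot_derivative h h6 h5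
      exact absurd h9 (hDuvK c (h3.trans_le h7) (h8.trans_lt h2))
  have hpx' : (p.map f).eval x = 0 := by rw [eval_map, hpx]
  -- `x` is a simple root of `p`, and the only root between `u` and `v`.
  have hsign : f (p.eval u) * f (p.eval v) < 0 := by
    obtain ⟨q, hq⟩ := dvd_iff_isRoot.2 hpx'
    have hqpos := IsRealClosed.eval_mul_eval_pos_of_no_root (f := q) (a := f u) (b := f v) (by
      intro w h1 h2 hw
      have hw' : (p.map f).eval w = 0 := by rw [hq, eval_mul, hw, mul_zero]
      have h1' : f u < w := lt_of_le_of_ne h1 fun h => hnoroot u (hf (by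
        rw [← hmapF, h, hw', map_zero]))
      have h2' : w < f v := lt_of_le_of_ne h2 fun h => hnoroot v (hf (by
        rw [← hmapF, ← h, hw', map_zero]))
      rcases lt_trichotomy w x with h | h | h
      · exact huniqF w x h1' h hxv hw' hpx'
      · subst h
        refine hDuv w h1' h2' ?_
        rw [hq]
        simp [hw]
      · exact huniqF x w hux h h2' hpx' hw') (hux.trans hxv).le
    rw [← hmapF, ← hmapF, hq]
    simp only [eval_mul, eval_sub, eval_X, eval_C]
    have h3 : (f u - x) * (f v - x) < 0 :=
      mul_neg_of_neg_of_pos (sub_neg.2 hux) (sub_pos.2 hxv)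
    have := mul_neg_of_neg_of_pos h3 hqpos
    linarith
  have htrans : ∀ a b, f (p.eval a) * f (p.eval b) < 0 →
      (p.map g).eval (g a) * (p.map g).eval (g b) < 0 := fun a b h => by
    rw [← map_mul, ← map_zero f, hlt, map_mul, map_zero] at h
    rwa [hmapK, hmapK]
  have hne : ∀ a, f (p.eval a) ≠ 0 := fun a h => hnoroot a (hf (h.trans (map_zero f).symm))
  have huv : g u < g v := (hlt _ _).1 (hux.trans hxv)
  obtain ⟨y, hy1, hy2, hy⟩ := IsRealClosed.exists_isRoot_of_eval_mul_eval_neg huv (htrans u v hsign)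
  -- For `u < a < x` the sign of `p` changes between `a` and `v`, so `y`, the only root of `p` in
  -- `K` between `u` and `v`, lies above `a`; likewise for `x < a < v`.
  refine ⟨y, by rw [← eval_map, hy], fun a ha => ?_, fun a ha => ?_⟩
  · rcases le_or_gt (f a) (f u) with h | h
    · refine lt_of_le_of_lt ?_ hy1
      rw [← not_lt, ← hlt, not_lt]
      exact h
    have h1 : 0 < f (p.eval u) * f (p.eval a) := by
      refine lt_of_not_ge fun hle => ?_
      obtain ⟨c, h3, h4, h5⟩ := IsRealClosed.exists_isRoot_of_eval_mul_eval_neg (f := p.map f) h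
        (by rw [hmapF, hmapF]; exact lt_of_le_of_ne hle (mul_ne_zero (hne _) (hne _)))
      exact huniqF c x h3 (h4.trans ha) hxv h5 hpx'
    have h2 : f (p.eval a) * f (p.eval v) < 0 := by
      rcases mul_pos_iff.1 h1 with h1 | h1
      · exact mul_neg_of_pos_of_neg h1.2 (by nlinarith [hsign, h1.1])
      · exact mul_neg_of_neg_of_pos h1.2 (by nlinarith [hsign, h1.1])
    obtain ⟨c, h3, h4, h5⟩ := IsRealClosed.exists_isRoot_of_eval_mul_eval_neg
      ((hlt _ _).1 (ha.trans hxv)) (htrans a v h2)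
    rwa [huniqK y c hy1 hy2 (((hlt _ _).1 h).trans h3) h4 hy h5]
  · rcases le_or_gt (f v) (f a) with h | h
    · refine lt_of_lt_of_le hy2 ?_
      rw [← not_lt, ← hlt, not_lt]
      exact h
    have h1 : 0 < f (p.eval a) * f (p.eval v) := by
      refine lt_of_not_ge fun hle => ?_
      obtain ⟨c, h3, h4, h5⟩ := IsRealClosed.exists_isRoot_of_eval_mul_eval_neg (f := p.map f) h
        (by rw [hmapF, hmapF]; exact lt_of_le_of_ne hle (mul_ne_zero (hne _) (hne _)))
      exact huniqF x c hux (ha.trans h3) h4 hpx' h5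
    have h2 : f (p.eval u) * f (p.eval a) < 0 := by
      rcases mul_pos_iff.1 h1 with h1 | h1
      · exact mul_neg_of_neg_of_pos (by nlinarith [hsign, h1.2]) h1.1
      · exact mul_neg_of_pos_of_neg (by nlinarith [hsign, h1.2]) h1.1
    obtain ⟨c, h3, h4, h5⟩ := IsRealClosed.exists_isRoot_of_eval_mul_eval_neg
      ((hlt _ _).1 (hux.trans ha)) (htrans u a h2)
    rwa [huniqK y c hy1 hy2 h3 (h4.trans ((hlt _ _).1 h)) hy h5]

/-- In the situation of `exists_root_of_cut`, the field generated by the root `x` embeds into `K`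
over `A` as an ordered field. -/
theorem exists_root_eval₂_pos_iff [IsRealClosed F] [IsRealClosed K] (hA : IsField A)
    (hfg : ∀ a, 0 < f a ↔ 0 < g a) {x : F} (hx : x ∉ Set.range f)
    (n : ℕ) (hF : ∀ q : A[X], q ≠ 0 → q.natDegree ≤ n → ∀ z, q.eval₂ f z = 0 → z ∈ Set.range f)
    (hK : ∀ q : A[X], q ≠ 0 → q.natDegree ≤ n → ∀ z, q.eval₂ g z = 0 → z ∈ Set.range g)
    {p : A[X]} (hp : p.natDegree = n + 1) (hpx : p.eval₂ f x = 0) :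
    ∃ y : K, p.eval₂ g y = 0 ∧ ∀ q : A[X], 0 < q.eval₂ f x ↔ 0 < q.eval₂ g y := by
  obtain ⟨y, hpy, hlt, hgt⟩ := exists_root_of_cut hA hfg hx n hF hK hp hpx
  let := hA.toField
  have hp0 : p ≠ 0 := by
    rintro rfl
    simp at hp
  have hm : (p * C p.leadingCoeff⁻¹).Monic := monic_mul_leadingCoeff_inv hp0
  have hdeg : (p * C p.leadingCoeff⁻¹).natDegree = n + 1 := by
    rw [natDegree_mul_leadingCoeff_inv p hp0, hp]
  have hne : p * C p.leadingCoeff⁻¹ ≠ 1 := by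
    intro h
    rw [h, natDegree_one] at hdeg
    omega
  refine ⟨y, hpy, fun q => ?_⟩
  have hlt' := natDegree_modByMonic_lt q hm hne
  have h1 := eval₂_pos_iff_of_cut f.injective hfg hx hlt hgt n hF hK
    (q %ₘ (p * C p.leadingCoeff⁻¹)) (by omega)
  rwa [eval₂_modByMonic_eq_self_of_root (by rw [eval₂_mul, hpx, zero_mul]),
    eval₂_modByMonic_eq_self_of_root (by rw [eval₂_mul, hpy, zero_mul])] at h1

theorem mul_inv_pow_pos_iff {R : Type*} [Field R] [LinearOrder R] [IsStrictOrderedRing R] {x y : R}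
    (hx : x ≠ 0) (n : ℕ) : 0 < y * x⁻¹ ^ n ↔ 0 < y * x ^ n := by
  have h1 : y * x ^ n = y * x⁻¹ ^ n * (x ^ n * x ^ n) := by
    rw [inv_pow]
    field_simp
  rw [h1, mul_pos_iff_of_pos_right (mul_self_pos.2 (pow_ne_zero n hx))]

/-- A common ordered subring remains one when the inverse of one of its elements is adjoined: the
sign of `q c⁻¹` is that of the value of the reversed polynomial at `c`, up to an even power. -/
theorem eval₂_inv_pos_iff (hfg : ∀ a, 0 < f a ↔ 0 < g a) {c : A} (hf : f c ≠ 0) (q : A[X]) :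
    0 < q.eval₂ f (f c)⁻¹ ↔ 0 < q.eval₂ g (g c)⁻¹ := by
  have hg : g c ≠ 0 := fun h => hf ((map_eq_zero_iff_of_pos_iff hfg c).2 h)
  let := invertibleOfNonzero (inv_ne_zero hf)
  let := invertibleOfNonzero (inv_ne_zero hg)
  rw [← eval₂_reverse_mul_pow f (f c)⁻¹ q, ← eval₂_reverse_mul_pow g (g c)⁻¹ q, invOf_eq_inv,
    invOf_eq_inv, inv_inv, inv_inv, mul_inv_pow_pos_iff hf,
    mul_inv_pow_pos_iff hg, eval₂_at_apply, eval₂_at_apply, ← map_pow, ← map_pow, ← map_mul,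
    ← map_mul, hfg]

end Cut

/-! ### Concordant subrings -/

/-- A subring of a product of two ordered fields is concordant if both components of each of its
elements have the same sign. Such a subring is the graph of an order isomorphism between a subring
of the first field and a subring of the second one. -/
def Subring.Concordant {F K : Type*} [Field F] [LinearOrder F] [Field K] [LinearOrder K]
    (S : Subring (F × K)) : Prop :=
  ∀ z ∈ S, 0 < z.1 ↔ 0 < z.2

/-- A subfield `k` of `F` is relatively algebraically closed if it contains all roots in `F` of
nonzero polynomials with coefficients in `k`. -/
def Subfield.IsRelativelyClosed {F : Type*} [Field F] (k : Subfield F) : Prop :=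
  ∀ p : Polynomial F, p ≠ 0 → (∀ i, p.coeff i ∈ k) → ∀ x, p.eval x = 0 → x ∈ k

/-- The relative algebraic closure of the subfield generated by `s`. -/
theorem Subfield.exists_isRelativelyClosed {F : Type u} [Field F] {κ : Cardinal.{u}} (hκ : ℵ₀ < κ)
    (s : Set F) (hs : #s < κ) : ∃ k : Subfield F, s ⊆ k ∧ #k < κ ∧ k.IsRelativelyClosed := by
  let k₀ := Subfield.closure s
  have hk₀ : #k₀ < κ := (Subfield.cardinalMk_closure_le_max s).trans_lt (max_lt hs hκ)
  refine ⟨(algebraicClosure k₀ F).toSubfield, fun x hx => ?_, ?_, ?_⟩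
  · exact (algebraicClosure k₀ F).algebraMap_mem ⟨x, Subfield.subset_closure hx⟩
  · have := Algebra.IsAlgebraic.cardinalMk_le_max k₀ (algebraicClosure k₀ F)
    exact this.trans_lt (max_lt hk₀ hκ)
  · intro p hp hcoeff x hx
    obtain ⟨q, rfl⟩ : ∃ q : Polynomial (algebraicClosure k₀ F),
        q.map (algebraMap (algebraicClosure k₀ F) F) = p := by
      rw [← Polynomial.mem_lifts, Polynomial.lifts_iff_coeff_lifts]
      exact fun i => ⟨⟨_, hcoeff i⟩, rfl⟩
    have halg : IsAlgebraic (algebraicClosure k₀ F) x := by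
      refine ⟨q, ?_, by rwa [Polynomial.eval_map_algebraMap] at hx⟩
      rintro rfl
      simp at hp
    exact mem_algebraicClosure_iff.2 (halg.restrictScalars k₀)

namespace Subring.Concordant

open Polynomial

variable {F K : Type*} [Field F] [LinearOrder F] [Field K] [LinearOrder K] {S : Subring (F × K)}

/-- If the signs of polynomials over a subring `S` at `x` and at `y` agree, then the
subring generated by `S` and `(x, y)` is concordant. -/
theorem exists_adjoin {x : F} {y : K}
    (h : ∀ q : S[X], 0 < q.eval₂ ((RingHom.fst F K).comp S.subtype) x ↔
      0 < q.eval₂ ((RingHom.snd F K).comp S.subtype) y) :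
    ∃ S' : Subring (F × K), S ≤ S' ∧ (x, y) ∈ S' ∧ S'.Concordant ∧
      (∀ T : Subring (F × K), S ≤ T → (x, y) ∈ T → S' ≤ T) ∧ #S' ≤ max #S ℵ₀ := by
  refine ⟨(eval₂RingHom S.subtype (x, y)).range, fun z hz => ⟨C ⟨z, hz⟩, by simp⟩, ⟨X, by simp⟩,
    ?_, ?_, ?_⟩
  · rintro _ ⟨q, rfl⟩
    have h1 := hom_eval₂ q S.subtype (RingHom.fst F K) (x, y)
    have h2 := hom_eval₂ q S.subtype (RingHom.snd F K) (x, y)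
    have h3 := h q
    simp only [RingHom.coe_fst, RingHom.coe_snd] at h1 h2
    rw [← h1, ← h2] at h3
    exact h3
  · rintro T hST hxy _ ⟨q, rfl⟩
    rw [coe_eval₂RingHom, eval₂_eq_sum_range]
    exact sum_mem fun i _ => mul_mem (hST (q.coeff i).2) (pow_mem hxy i)
  · have h1 : #(eval₂RingHom S.subtype (x, y)).range ≤ #(S[X]) :=
      Cardinal.mk_le_of_surjective (f := (eval₂RingHom S.subtype (x, y)).rangeRestrict)
        (RingHom.rangeRestrict_surjective _)
    exact h1.trans Polynomial.cardinalMk_le_max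

theorem sSup {c : Set (Subring (F × K))} (hc : IsChain (· ≤ ·) c) (hne : c.Nonempty)
    (h : ∀ s ∈ c, s.Concordant) : (sSup c).Concordant := by
  intro z hz
  obtain ⟨s, hs, hz⟩ := (Subring.mem_sSup_of_directedOn hne hc.directedOn).1 hz
  exact h s hs z hz

theorem exists_maximal (hS : S.Concordant) (T : Subring (F × K)) (hST : S ≤ T) :
    ∃ M, S ≤ M ∧ Maximal (fun M : Subring (F × K) => M ≤ T ∧ M.Concordant) M := by
  refine zorn_le_nonempty₀ {M : Subring (F × K) | M ≤ T ∧ M.Concordant} ?_ S ⟨hST, hS⟩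
  intro c hc hchain M hM
  exact ⟨_, ⟨sSup_le fun s hs => (hc hs).1, Concordant.sSup hchain ⟨M, hM⟩ fun s hs => (hc hs).2⟩,
    fun s hs => le_sSup hs⟩

variable {k : Subfield F} {l : Subfield K} {M : Subring (F × K)}

theorem mem_of_maximal
    (hM : Maximal (fun M : Subring (F × K) => M ≤ k.toSubring.prod l.toSubring ∧ M.Concordant) M)
    {x : F} {y : K} (hx : x ∈ k) (hy : y ∈ l)
    (h : ∀ q : M[X], 0 < q.eval₂ ((RingHom.fst F K).comp M.subtype) x ↔
      0 < q.eval₂ ((RingHom.snd F K).comp M.subtype) y) : (x, y) ∈ M := by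
  obtain ⟨S', hMS, hxy, hS', hT, -⟩ := exists_adjoin h
  exact hM.le_of_ge ⟨hT _ hM.prop.1 ⟨hx, hy⟩, hS'⟩ hMS hxy

variable [IsStrictOrderedRing F] [IsStrictOrderedRing K]

theorem fst_eq_zero_iff (hS : S.Concordant) {z : F × K} (hz : z ∈ S) : z.1 = 0 ↔ z.2 = 0 :=
  map_eq_zero_iff_of_pos_iff (f := (RingHom.fst F K).comp S.subtype)
    (g := (RingHom.snd F K).comp S.subtype) (fun a => hS a a.2) ⟨z, hz⟩

theorem fst_injOn (hS : S.Concordant) : Set.InjOn Prod.fst (S : Set (F × K)) := by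
  intro z hz w hw h
  have h1 : (z - w).1 = 0 := by rw [Prod.fst_sub, h, sub_self]
  have h2 := (hS.fst_eq_zero_iff (S.sub_mem hz hw)).1 h1
  exact Prod.ext h (sub_eq_zero.1 h2)

theorem snd_injOn (hS : S.Concordant) : Set.InjOn Prod.snd (S : Set (F × K)) := by
  intro z hz w hw h
  have h1 : (z - w).2 = 0 := by rw [Prod.snd_sub, h, sub_self]
  have h2 := (hS.fst_eq_zero_iff (S.sub_mem hz hw)).2 h1
  exact Prod.ext (sub_eq_zero.1 h2) h

/-- A maximal concordant subring within a product of subfields contains the inverses of its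
elements. -/
theorem isField_of_maximal
    (hM : Maximal (fun M : Subring (F × K) => M ≤ k.toSubring.prod l.toSubring ∧ M.Concordant) M) :
    IsField M where
  exists_pair_ne := ⟨0, 1, zero_ne_one⟩
  mul_comm := mul_comm
  mul_inv_cancel := by
    rintro ⟨⟨a, b⟩, hz⟩ hne
    have ha : a ≠ 0 := fun ha => hne (Subtype.ext (Prod.ext ha
      ((hM.prop.2.fst_eq_zero_iff hz).1 ha)))
    have hb : b ≠ 0 := fun hb => ha ((hM.prop.2.fst_eq_zero_iff hz).2 hb)
    have hmem := mem_of_maximal hM (k.inv_mem (hM.prop.1 hz).1) (l.inv_mem (hM.prop.1 hz).2)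
      (eval₂_inv_pos_iff (f := (RingHom.fst F K).comp M.subtype)
        (g := (RingHom.snd F K).comp M.subtype) (fun a => hM.prop.2 a a.2) (c := ⟨(a, b), hz⟩) ha)
    exact ⟨⟨_, hmem⟩, Subtype.ext (Prod.ext (mul_inv_cancel₀ ha) (mul_inv_cancel₀ hb))⟩

/-- A maximal concordant subring within the product of two relatively algebraically closed subfields
contains the roots of polynomials over it, in either field: by induction on the degree, a missing
root could be adjoined together with a root in the other field that has the same cut. -/
theorem roots_mem_of_maximal [IsRealClosed F] [IsRealClosed K]
    (hM : Maximal (fun M : Subring (F × K) => M ≤ k.toSubring.prod l.toSubring ∧ M.Concordant) M)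
    (hk : k.IsRelativelyClosed) (hl : l.IsRelativelyClosed) (n : ℕ) :
    (∀ q : M[X], q ≠ 0 → q.natDegree ≤ n → ∀ z, q.eval₂ ((RingHom.fst F K).comp M.subtype) z = 0 →
      z ∈ Set.range ((RingHom.fst F K).comp M.subtype)) ∧
    (∀ q : M[X], q ≠ 0 → q.natDegree ≤ n → ∀ z, q.eval₂ ((RingHom.snd F K).comp M.subtype) z = 0 →
      z ∈ Set.range ((RingHom.snd F K).comp M.subtype)) := by
  have hA := isField_of_maximal hM
  have hfg : ∀ a, 0 < (RingHom.fst F K).comp M.subtype a ↔ 0 < (RingHom.snd F K).comp M.subtype a :=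
    fun a => hM.prop.2 a a.2
  let := hA.toField
  have hf := ((RingHom.fst F K).comp M.subtype).injective
  have hg := ((RingHom.snd F K).comp M.subtype).injective
  have hroot_k : ∀ q : M[X], q ≠ 0 →
      ∀ z, q.eval₂ ((RingHom.fst F K).comp M.subtype) z = 0 → z ∈ k := by
    intro q hq z hz
    refine hk (q.map ((RingHom.fst F K).comp M.subtype)) ?_ (fun i => ?_) z (by rwa [eval_map])
    · rwa [Ne, Polynomial.map_eq_zero_iff hf]
    · rw [coeff_map]
      exact (hM.prop.1 (q.coeff i).2).1
  have hroot_l : ∀ q : M[X], q ≠ 0 →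
      ∀ z, q.eval₂ ((RingHom.snd F K).comp M.subtype) z = 0 → z ∈ l := by
    intro q hq z hz
    refine hl (q.map ((RingHom.snd F K).comp M.subtype)) ?_ (fun i => ?_) z (by rwa [eval_map])
    · rwa [Ne, Polynomial.map_eq_zero_iff hg]
    · rw [coeff_map]
      exact (hM.prop.1 (q.coeff i).2).2
  induction n with
  | zero =>
    constructor <;>
    · intro q hq hdeg z hz
      rw [eq_C_of_natDegree_le_zero hdeg, eval₂_C, map_eq_zero] at hz
      rw [eq_C_of_natDegree_le_zero hdeg, hz, C_0] at hq
      exact absurd rfl hq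
  | succ n ih =>
    obtain ⟨ihF, ihK⟩ := ih
    constructor
    · intro q hq hdeg z hz
      rcases hdeg.lt_or_eq with hlt | heq
      · exact ihF q hq (by omega) z hz
      by_contra hzr
      obtain ⟨y, hy, hsign⟩ := exists_root_eval₂_pos_iff hA hfg hzr n ihF ihK heq hz
      exact hzr ⟨⟨_, mem_of_maximal hM (hroot_k q hq z hz) (hroot_l q hq y hy) hsign⟩, rfl⟩
    · intro q hq hdeg z hz
      rcases hdeg.lt_or_eq with hlt | heq
      · exact ihK q hq (by omega) z hz
      by_contra hzr
      obtain ⟨y, hy, hsign⟩ := exists_root_eval₂_pos_iff hA (fun a => (hfg a).symm) hzr n ihK ihF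
        heq hz
      exact hzr ⟨⟨_, mem_of_maximal hM (hroot_k q hq y hy) (hroot_l q hq z hz)
        fun r => (hsign r).symm⟩, rfl⟩

end Subring.Concordant

/-- A linear order is an `η`-set for the cardinal `κ` if every cut defined by fewer than `κ`
elements on either side is filled. -/
def IsEtaOrder (κ : Cardinal.{u}) (K : Type u) [LT K] : Prop :=
  ∀ L U : Set K, #L < κ → #U < κ → (∀ a ∈ L, ∀ b ∈ U, a < b) →
    ∃ y, (∀ a ∈ L, a < y) ∧ ∀ b ∈ U, y < b

/-- The forth step: a small concordant subring can be enlarged so as to contain a given `x` in its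
first projection. It suffices to do so for a maximal concordant subring within
the relative algebraic closures; there all signs are determined by the cut of `x`, and the second
field fills this cut. -/
theorem Subring.Concordant.exists_extension {F K : Type u} [Field F] [LinearOrder F]
    [IsStrictOrderedRing F] [Field K] [LinearOrder K] [IsStrictOrderedRing K] [IsRealClosed F]
    [IsRealClosed K] {κ : Cardinal.{u}} (hκ : ℵ₀ < κ) (hK : IsEtaOrder κ K) {S : Subring (F × K)}
    (hS : S.Concordant) (hcard : #S < κ) (x : F) :
    ∃ S' : Subring (F × K), S ≤ S' ∧ S'.Concordant ∧ #S' < κ ∧ ∃ y, (x, y) ∈ S' := by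
  obtain ⟨k, hSk, hkκ, hk⟩ := Subfield.exists_isRelativelyClosed hκ (Prod.fst '' (S : Set (F × K)))
    (Cardinal.mk_image_le.trans_lt hcard)
  obtain ⟨l, hSl, -, hl⟩ := Subfield.exists_isRelativelyClosed hκ (Prod.snd '' (S : Set (F × K)))
    (Cardinal.mk_image_le.trans_lt hcard)
  obtain ⟨M, hSM, hM⟩ := hS.exists_maximal (k.toSubring.prod l.toSubring)
    fun z hz => ⟨hSk ⟨z, hz, rfl⟩, hSl ⟨z, hz, rfl⟩⟩
  have hMκ : #M < κ := by
    refine lt_of_le_of_lt ?_ hkκ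
    exact Cardinal.mk_le_of_injective (f := fun z : M => (⟨z.1.1, (hM.prop.1 z.2).1⟩ : k))
      fun z w h => Subtype.ext (hM.prop.2.fst_injOn z.2 w.2 (congrArg Subtype.val h))
  by_cases hx : x ∈ Set.range ((RingHom.fst F K).comp M.subtype)
  · obtain ⟨⟨⟨a, b⟩, hz⟩, rfl⟩ := hx
    exact ⟨M, hSM, hM.prop.2, hMκ, b, hz⟩
  have hfg : ∀ a, 0 < (RingHom.fst F K).comp M.subtype a ↔ 0 < (RingHom.snd F K).comp M.subtype a :=
    fun a => hM.prop.2 a a.2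
  obtain ⟨y, hy1, hy2⟩ := hK
    ((RingHom.snd F K).comp M.subtype '' {a | (RingHom.fst F K).comp M.subtype a < x})
    ((RingHom.snd F K).comp M.subtype '' {a | x < (RingHom.fst F K).comp M.subtype a})
    (Cardinal.mk_image_le.trans_lt ((Cardinal.mk_set_le _).trans_lt hMκ))
    (Cardinal.mk_image_le.trans_lt ((Cardinal.mk_set_le _).trans_lt hMκ)) (by
      rintro _ ⟨a, ha, rfl⟩ _ ⟨b, hb, rfl⟩
      exact (map_lt_map_iff_of_pos_iff hfg a b).1 (lt_trans ha hb))
  obtain ⟨S', h1, h2, h3, -, h5⟩ := exists_adjoin (S := M) (x := x) (y := y) fun q =>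
    eval₂_pos_iff_of_cut
      (fun z w h => Subtype.ext (hM.prop.2.fst_injOn z.2 w.2 h)) hfg hx
      (fun a ha => hy1 _ ⟨a, ha, rfl⟩) (fun a ha => hy2 _ ⟨a, ha, rfl⟩) q.natDegree
      (roots_mem_of_maximal hM hk hl _).1 (roots_mem_of_maximal hM hk hl _).2 q le_rfl
  exact ⟨S', hSM.trans h1, h3, h5.trans_lt (max_lt hMκ hκ), y, h2⟩

/-! ### Back and forth -/

namespace Subring.Concordant

variable {F K : Type u} [Field F] [LinearOrder F] [IsStrictOrderedRing F]
  [Field K] [LinearOrder K] [IsStrictOrderedRing K] {S : Subring (F × K)}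

theorem ringEquiv (hS : S.Concordant) (h1 : ∀ x, ∃ y, (x, y) ∈ S) (h2 : ∀ y, ∃ x, (x, y) ∈ S) :
    Nonempty (F ≃+* K) := by
  have hF : Function.Bijective ((RingHom.fst F K).comp S.subtype) :=
    ⟨fun z w h => Subtype.ext (hS.fst_injOn z.2 w.2 h), fun x =>
      let ⟨y, hy⟩ := h1 x
      ⟨⟨(x, y), hy⟩, rfl⟩⟩
  have hK : Function.Bijective ((RingHom.snd F K).comp S.subtype) :=
    ⟨fun z w h => Subtype.ext (hS.snd_injOn z.2 w.2 h), fun y =>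
      let ⟨x, hx⟩ := h2 y
      ⟨⟨(x, y), hx⟩, rfl⟩⟩
  exact ⟨(RingEquiv.ofBijective _ hF).symm.trans (RingEquiv.ofBijective _ hK)⟩

theorem bot : (⊥ : Subring (F × K)).Concordant := by
  intro z hz
  obtain ⟨n, rfl⟩ := Subring.mem_bot.1 hz
  simp

/-- The back step is the forth step with the two fields exchanged. -/
theorem exists_extension_both [IsRealClosed F] [IsRealClosed K] {κ : Cardinal.{u}} (hκ : ℵ₀ < κ)
    (hF : IsEtaOrder κ F) (hK : IsEtaOrder κ K) (hS : S.Concordant) (hcard : #S < κ) (x : F)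
    (y : K) :
    ∃ S' : Subring (F × K), S ≤ S' ∧ S'.Concordant ∧ #S' < κ ∧ (∃ y, (x, y) ∈ S') ∧
      ∃ x, (x, y) ∈ S' := by
  obtain ⟨S₁, h1, h2, h3, y', hy'⟩ := hS.exists_extension hκ hK hcard x
  let e : K × F ≃+* F × K := RingEquiv.prodComm
  have hcomap : ∀ T : Subring (F × K), #(T.comap (e : K × F →+* F × K)) = #T := fun T =>
    Cardinal.mk_congr (e.toEquiv.subtypeEquiv fun _ => Iff.rfl)
  obtain ⟨S₂, h4, h5, h6, x', hx'⟩ := exists_extension (S := S₁.comap (e : K × F →+* F × K)) hκ hF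
    (fun z hz => (h2 _ hz).symm) (by rwa [hcomap]) y
  refine ⟨S₂.comap (e.symm : F × K →+* K × F), fun z hz => h4 (show e (e.symm z) ∈ S₁ from ?_),
    fun z hz => (h5 _ hz).symm, ?_, ⟨y', h4 hy'⟩, x', hx'⟩
  · rw [e.apply_symm_apply]
    exact h1 hz
  · rwa [show #(S₂.comap (e.symm : F × K →+* K × F)) = #S₂ from
      Cardinal.mk_congr (e.symm.toEquiv.subtypeEquiv fun _ => Iff.rfl)]

end Subring.Concordant

theorem mk_Iio_ord_toType_lt {κ : Cardinal.{u}} (i : κ.ord.ToType) : #(Set.Iio i) < κ := by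
  simpa using Cardinal.mk_Iio_lt i (by simp)

/-- Back and forth of length `κ`: two real closed fields of regular uncountable cardinality `κ` that
are `η`-sets for `κ` are isomorphic. Stage `i` extends the union of the previous stages, which is
small because `κ` is regular, by the elements with index `i` of both fields. -/
theorem nonempty_ringEquiv_of_isEtaOrder {F K : Type u} [Field F] [LinearOrder F]
    [IsStrictOrderedRing F] [Field K] [LinearOrder K] [IsStrictOrderedRing K] [IsRealClosed F]
    [IsRealClosed K] {κ : Cardinal.{u}} (hκ : ℵ₀ < κ) (hreg : κ.IsRegular)
    (hF : IsEtaOrder κ F) (hK : IsEtaOrder κ K) (hFκ : #F = κ) (hKκ : #K = κ) :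
    Nonempty (F ≃+* K) := by
  classical
  let I := κ.ord.ToType
  have hI : #I = κ := by simp [I]
  obtain ⟨eF⟩ := Cardinal.eq.1 (hI.trans hFκ.symm)
  obtain ⟨eK⟩ := Cardinal.eq.1 (hI.trans hKκ.symm)
  have hstep : ∀ (S : Subring (F × K)) (i : I), ∃ S' : Subring (F × K), S.Concordant → #S < κ →
      S ≤ S' ∧ S'.Concordant ∧ #S' < κ ∧ (∃ y, (eF i, y) ∈ S') ∧ ∃ x, (x, eK i) ∈ S' := by
    intro S i
    by_cases h : S.Concordant ∧ #S < κ
    · obtain ⟨S', h'⟩ := h.1.exists_extension_both hκ hF hK h.2 (eF i) (eK i)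
      exact ⟨S', fun _ _ => h'⟩
    · exact ⟨S, fun h1 h2 => absurd ⟨h1, h2⟩ h⟩
  choose ext hext using hstep
  let G : I → Subring (F × K) := wellFounded_lt.fix fun i G =>
    ext (sSup (insert ⊥ (Set.range fun j : Set.Iio i => G j j.2))) i
  have hG : ∀ i, G i = ext (sSup (insert ⊥ (Set.range fun j : Set.Iio i => G j))) i := fun i =>
    wellFounded_lt.fix_eq _ i
  have hmain : ∀ i, ((G i).Concordant ∧ #(G i) < κ ∧ (∃ y, (eF i, y) ∈ G i) ∧
      (∃ x, (x, eK i) ∈ G i)) ∧ ∀ j < i, G j ≤ G i := by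
    intro i
    induction i using WellFoundedLT.induction with
    | _ i ih =>
    have hchain : IsChain (· ≤ ·) (insert ⊥ (Set.range fun j : Set.Iio i => G j)) := by
      refine IsChain.insert ?_ fun _ _ _ => Or.inl bot_le
      rintro _ ⟨⟨j, hj⟩, rfl⟩ _ ⟨⟨k, hk⟩, rfl⟩ -
      rcases lt_trichotomy j k with h | h | h
      · exact Or.inl ((ih k hk).2 j h)
      · subst h
        exact Or.inl le_rfl
      · exact Or.inr ((ih j hj).2 k h)
    have hne := Set.insert_nonempty ⊥ (Set.range fun j : Set.Iio i => G j)
    have hconc : (sSup (insert ⊥ (Set.range fun j : Set.Iio i => G j))).Concordant := by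
      refine Subring.Concordant.sSup hchain hne ?_
      rintro _ (rfl | ⟨⟨j, hj⟩, rfl⟩)
      · exact Subring.Concordant.bot
      · exact (ih j hj).1.1
    have hsmall :
        #(sSup (insert ⊥ (Set.range fun j : Set.Iio i => G j)) : Subring (F × K)) < κ := by
      have h1 : ((sSup (insert ⊥ (Set.range fun j : Set.Iio i => G j)) : Subring (F × K)) :
          Set (F × K)) = ↑(⊥ : Subring (F × K)) ∪ ⋃ j : Set.Iio i, (G j : Set (F × K)) := by
        ext z
        rw [SetLike.mem_coe, Subring.mem_sSup_of_directedOn hne hchain.directedOn]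
        simp
      have h2 : #(((⊥ : Subring (F × K)) : Set (F × K))) ≤ ℵ₀ := by
        rw [Subring.coe_bot, Cardinal.le_aleph0_iff_set_countable]
        exact Set.countable_range _
      have h3 : #(⋃ j : Set.Iio i, (G j : Set (F × K))) < κ := by
        rw [Cardinal.card_iUnion_lt_iff_forall_of_isRegular hreg]
        · exact fun j => (ih j j.2).1.2.1
        · exact mk_Iio_ord_toType_lt i
      change #((sSup (insert ⊥ (Set.range fun j : Set.Iio i => G j)) : Subring (F × K)) :
          Set (F × K)) < κ
      rw [h1]
      exact (Cardinal.mk_union_le _ _).trans_lt (Cardinal.add_lt_of_lt hκ.le (h2.trans_lt hκ) h3)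
    have := hext _ i hconc hsmall
    rw [← hG] at this
    refine ⟨this.2, fun j hj => le_trans ?_ this.1⟩
    exact le_sSup (Or.inr ⟨⟨j, hj⟩, rfl⟩)
  have hchain : IsChain (· ≤ ·) (Set.range G) := by
    rintro _ ⟨j, rfl⟩ _ ⟨k, rfl⟩ -
    rcases lt_trichotomy j k with h | h | h
    · exact Or.inl ((hmain k).2 j h)
    · subst h
      exact Or.inl le_rfl
    · exact Or.inr ((hmain j).2 k h)
  have hIne : Nonempty I := ⟨eF.symm 0⟩
  have hle : ∀ i, G i ≤ sSup (Set.range G) := fun i => le_sSup ⟨i, rfl⟩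
  refine (Subring.Concordant.sSup hchain (Set.range_nonempty G) ?_).ringEquiv (fun x => ?_)
    fun y => ?_
  · rintro _ ⟨i, rfl⟩
    exact (hmain i).1.1
  · obtain ⟨y, hy⟩ := (hmain (eF.symm x)).1.2.2.1
    rw [eF.apply_symm_apply] at hy
    exact ⟨y, hle _ hy⟩
  · obtain ⟨x, hx⟩ := (hmain (eK.symm y)).1.2.2.2
    rw [eK.apply_symm_apply] at hx
    exact ⟨x, hle _ hx⟩

/-! ### Saturated real closed fields as `η`-sets -/

section Saturated

open FirstOrder FirstOrder.Language FirstOrder.Ring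

/-- The formula `s < t` in the language of rings: `t ≠ s` and `t - s` is a square. -/
noncomputable def ringLtFormula {α : Type*} (s t : α) : Language.ring.Formula α :=
  ∼((Term.var s).equal (Term.var t)) ⊓
    ∃' (((Term.var (Sum.inl t)) =' (Term.var (Sum.inl s) + &0 * &0)) :
      Language.ring.BoundedFormula α 1)

theorem realize_ringLtFormula {F α : Type*} [Field F] [CompatibleRing F] (s t : α) (v : α → F) :
    (ringLtFormula s t).Realize v ↔ v s ≠ v t ∧ ∃ z, v t = v s + z * z := by
  unfold ringLtFormula
  rw [Formula.realize_inf, Formula.realize_not, Formula.realize_equal]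
  refine and_congr Iff.rfl ?_
  simp [Formula.Realize, Fin.snoc]

/-- A cut defined by fewer than `#F` elements is a type with these elements as parameters, finitely
satisfiable because the order is dense and has no endpoints. -/
theorem IsSaturatedRealClosedField.isEtaOrder {F : Type u} [Field F] [LinearOrder F]
    [IsStrictOrderedRing F] (h : IsSaturatedRealClosedField F) : IsEtaOrder #F F := by
  classical
  have := h.1
  have hsat := h.2
  let := compatibleRingOfRing F
  have hinf : ℵ₀ ≤ #F := Cardinal.infinite_iff.1 inferInstance
  have hlt : ∀ {α : Type u} (s t : α) (v : α → F), (ringLtFormula s t).Realize v ↔ v s < v t := by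
    intro α s t v
    rw [realize_ringLtFormula]
    constructor
    · rintro ⟨hne, z, hz⟩
      refine lt_of_le_of_ne ?_ hne
      rw [hz]
      exact le_add_of_nonneg_right (mul_self_nonneg z)
    · intro hlt
      obtain ⟨z, hz⟩ := IsSquare.of_nonneg (sub_nonneg.2 hlt.le)
      exact ⟨hlt.ne, z, by rw [← hz]; ring⟩
  intro L U hL hU hLU
  have hA : #(L ∪ U : Set F) < #F :=
    (Cardinal.mk_union_le _ _).trans_lt (Cardinal.add_lt_of_lt hinf hL hU)
  let θ : L ⊕ U → Language.ring.Formula ((L ∪ U : Set F) ⊕ Unit) :=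
    Sum.elim (fun a => ringLtFormula (Sum.inl ⟨a, Or.inl a.2⟩) (Sum.inr ()))
      fun b => ringLtFormula (Sum.inr ()) (Sum.inl ⟨b, Or.inr b.2⟩)
  obtain ⟨x, hx⟩ := hsat (L ∪ U) hA (Set.range θ) (by
    intro q hq hfin
    obtain ⟨s, hs⟩ : ∃ s : Finset (L ⊕ U), q ⊆ θ '' s := by
      choose r hr using fun φ : q => hq φ.2
      have := hfin.fintype
      exact ⟨Finset.univ.image r, fun φ hφ => ⟨r ⟨φ, hφ⟩, by simp, hr ⟨φ, hφ⟩⟩⟩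
    obtain ⟨x, hx1, hx2⟩ := Order.exists_between_finsets
      (s.toLeft.image Subtype.val) (s.toRight.image Subtype.val) (by
        intro a ha b hb
        simp only [Finset.mem_image] at ha hb
        obtain ⟨a, -, rfl⟩ := ha
        obtain ⟨b, -, rfl⟩ := hb
        exact hLU a a.2 b b.2)
    refine ⟨x, fun φ hφ => ?_⟩
    obtain ⟨a | b, hab, rfl⟩ := hs hφ
    · exact (hlt _ _ _).2 (hx1 a (Finset.mem_image_of_mem _ (Finset.mem_toLeft.2 hab)))
    · exact (hlt _ _ _).2 (hx2 b (Finset.mem_image_of_mem _ (Finset.mem_toRight.2 hab))))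
  exact ⟨x, fun a ha => (hlt _ _ _).1 (hx _ ⟨Sum.inl ⟨a, ha⟩, rfl⟩),
    fun b hb => (hlt _ _ _).1 (hx _ ⟨Sum.inr ⟨b, hb⟩, rfl⟩)⟩

end Saturated

/-! ### The cardinal arithmetic of `η`-sets -/

/-- A set `S` of fewer than `#F` indices that is cofinal in an enumeration `e` of `F` would give,
through bounds `b s` of the initial segments up to `s ∈ S`, a cofinal subset of `F` with fewer
than `#F` elements; but such a subset has a strict upper bound. -/
theorem IsEtaOrder.isRegular {F : Type u} [LinearOrder F] (hF : IsEtaOrder #F F) (hinf : ℵ₀ ≤ #F) :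
    (#F).IsRegular := by
  refine ⟨hinf, ?_⟩
  by_contra! hcof
  obtain ⟨e⟩ := Cardinal.eq.1 (Cardinal.mk_ord_toType #F)
  obtain ⟨S, hS, hcard⟩ := Order.exists_cof_eq (#F).ord.ToType
  rw [Ordinal.cof_toType] at hcard
  have hbound : ∀ A : Set F, #A < #F → ∃ b, ∀ a ∈ A, a < b := fun A hA => by
    obtain ⟨b, hb, -⟩ := hF A ∅ hA (by simpa using Cardinal.aleph0_pos.trans_le hinf) (by simp)
    exact ⟨b, hb⟩
  have h1 : ∀ s : (#F).ord.ToType, ∃ b : F, ∀ a ∈ e '' Set.Iic s, a < b := fun s => by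
    refine hbound _ (Cardinal.mk_image_le.trans_lt ?_)
    rw [← Set.Iio_insert]
    exact (Cardinal.mk_insert_le).trans_lt (Cardinal.add_lt_of_lt hinf
      (mk_Iio_ord_toType_lt s) (Cardinal.one_lt_aleph0.trans_le hinf))
  choose b hb using h1
  obtain ⟨c, hc⟩ := hbound (b '' S) (Cardinal.mk_image_le.trans_lt (hcard.trans_lt hcof))
  obtain ⟨s, hs, hcs⟩ := hS (e.symm c)
  have h2 := hb s c ⟨e.symm c, hcs, e.apply_symm_apply c⟩
  exact lt_asymm h2 (hc _ ⟨s, hs, rfl⟩)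

section Tree

variable {W F : Type u} [LinearOrder W] [WellFoundedLT W] [LinearOrder F] [Nonempty F]

/-- The element of an `η`-set coded by the sign sequence `f` up to `i`: an element that lies above
the element with index `j < i` if `f j` holds, and below it otherwise. -/
noncomputable def signNode (F : Type u) [LinearOrder F] [Nonempty F] (f : W → Prop) : W → F :=
  (wellFounded_lt (α := W)).fix fun i g =>
    Classical.epsilon fun y : F => ∀ j (h : j < i), (f j → g j h < y) ∧ (¬ f j → y < g j h)

theorem signNode_eq (f : W → Prop) (i : W) : signNode F f i =
    Classical.epsilon fun y : F => ∀ j, j < i →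
      (f j → signNode F f j < y) ∧ (¬ f j → y < signNode F f j) :=
  (wellFounded_lt (α := W)).fix_eq _ i

theorem signNode_congr {f f' : W → Prop} (i : W) (h : ∀ j < i, f j ↔ f' j) :
    signNode F f i = signNode F f' i := by
  induction i using WellFoundedLT.induction with
  | _ i ih =>
  rw [signNode_eq, signNode_eq]
  congr 1
  funext y
  refine propext (forall_congr' fun j => forall_congr' fun hj => ?_)
  rw [h j hj, ih j hj fun k hk => h k (hk.trans hj)]

/-- The cut that a sign sequence describes on an initial segment `D` of indices is filled. -/
theorem exists_signNode_bound (hF : IsEtaOrder #F F) (hW : #W < #F) (f : W → Prop) (D : Set W)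
    (h : ∀ i ∈ D, ∀ j < i, (f j → signNode F f j < signNode F f i) ∧
      (¬ f j → signNode F f i < signNode F f j)) :
    ∃ y : F, ∀ j ∈ D, (f j → signNode F f j < y) ∧ (¬ f j → y < signNode F f j) := by
  have hcard : ∀ E : Set W, #(signNode F f '' E) < #F := fun E =>
    Cardinal.mk_image_le.trans_lt ((Cardinal.mk_set_le E).trans_lt hW)
  obtain ⟨y, hy1, hy2⟩ := hF (signNode F f '' {j | j ∈ D ∧ f j})
    (signNode F f '' {j | j ∈ D ∧ ¬ f j}) (hcard _) (hcard _) (by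
      rintro _ ⟨j, ⟨hj, hfj⟩, rfl⟩ _ ⟨k, ⟨hk, hfk⟩, rfl⟩
      rcases lt_trichotomy j k with hjk | rfl | hjk
      · exact (h k hk j hjk).1 hfj
      · exact absurd hfj hfk
      · exact (h j hj k hjk).2 hfk)
  exact ⟨y, fun j hj =>
    ⟨fun hfj => hy1 _ ⟨j, ⟨hj, hfj⟩, rfl⟩, fun hfj => hy2 _ ⟨j, ⟨hj, hfj⟩, rfl⟩⟩⟩

theorem signNode_lt (hF : IsEtaOrder #F F) (hW : #W < #F) (f : W → Prop) (i : W) : ∀ j < i,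
    (f j → signNode F f j < signNode F f i) ∧ (¬ f j → signNode F f i < signNode F f j) := by
  induction i using WellFoundedLT.induction with
  | _ i ih =>
  have := Classical.epsilon_spec (exists_signNode_bound hF hW f (Set.Iio i) ih)
  rw [signNode_eq f i]
  exact this

end Tree

/-- An `η`-set for its own cardinality has at least `2 ^ c` elements for every smaller `c`: the
sequences of signs of length `c` are distinguished by the elements that they code. -/
theorem IsEtaOrder.two_power_le {F : Type u} [LinearOrder F] [Nonempty F] (hF : IsEtaOrder #F F)
    {c : Cardinal.{u}} (hc : c < #F) : 2 ^ c ≤ #F := by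
  let W := c.ord.ToType
  have hW : #W = c := Cardinal.mk_ord_toType c
  have h1 : ∀ f : W → Prop, ∃ y : F, ∀ j,
      (f j → signNode F f j < y) ∧ (¬ f j → y < signNode F f j) := fun f => by
    obtain ⟨y, hy⟩ := exists_signNode_bound hF (hW.trans_lt hc) f Set.univ
      fun i _ => signNode_lt hF (hW.trans_lt hc) f i
    exact ⟨y, fun j => hy j trivial⟩
  choose y hy using h1
  have hinj : Function.Injective y := by
    intro f f' hff
    by_contra hne
    obtain ⟨i₀, hi₀⟩ : ∃ i, ¬ (f i ↔ f' i) := by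
      by_contra! hall
      exact hne (funext fun i => propext (hall i))
    obtain ⟨i, hi, hmin⟩ := (wellFounded_lt (α := W)).has_min {i | ¬ (f i ↔ f' i)} ⟨i₀, hi₀⟩
    have hcongr := signNode_congr (F := F) (f := f) (f' := f') i fun j hj => by
      by_contra hcon
      exact hmin j hcon hj
    have h2 := hy f i
    have h3 := hy f' i
    rw [hff, hcongr] at h2
    by_cases hfi : f i
    · have hfi' : ¬ f' i := fun h => hi ⟨fun _ => h, fun _ => hfi⟩
      exact lt_asymm (h2.1 hfi) (h3.2 hfi')
    · have hfi' : f' i := by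
        by_contra h
        exact hi ⟨fun h' => absurd h' hfi, fun h' => absurd h' h⟩
      exact lt_asymm (h2.2 hfi) (h3.1 hfi')
  have h2 : #(Set W) ≤ #F := Cardinal.mk_le_of_injective (f := fun s : Set W => y (· ∈ s))
    fun s t hst => Set.ext fun i => iff_of_eq (congrFun (hinj hst) i)
  rwa [Cardinal.mk_set, hW] at h2

/-- As `κ` is regular, a function from a smaller set to `κ` is bounded, and there are at most
`2 ^ (i * c) ≤ κ` functions with values below `i`. -/
theorem Cardinal.IsRegular.powerlt_self {κ : Cardinal.{u}} (hκ : κ.IsRegular)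
    (h : ∀ c < κ, 2 ^ c ≤ κ) : κ ^< κ = κ := by
  refine le_antisymm (Cardinal.powerlt_le.2 fun c hc => ?_) ?_
  · let I := κ.ord.ToType
    have hI : #I = κ := Cardinal.mk_ord_toType κ
    have hbound : ∀ g : c.out → I, ∃ i, ∀ w, g w < i := by
      intro g
      by_contra! hcon
      have hcof : IsCofinal (Set.range g) := fun i => by
        obtain ⟨w, hw⟩ := hcon i
        exact ⟨g w, ⟨w, rfl⟩, hw⟩
      have h1 := Order.cof_le hcof
      rw [Ordinal.cof_toType, hκ.cof_ord] at h1
      have h2 := h1.trans Cardinal.mk_range_le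
      rw [Cardinal.mk_out] at h2
      exact absurd hc h2.not_gt
    choose b hb using hbound
    have h1 : #(c.out → I) ≤ #(Σ i : I, c.out → Set.Iio i) :=
      Cardinal.mk_le_of_injective (f := fun g => ⟨b g, fun w => ⟨g w, hb g w⟩⟩) (by
        intro g g' hgg
        have key : ∀ p : Σ i : I, c.out → Set.Iio i, p = ⟨b g, fun w => ⟨g w, hb g w⟩⟩ →
            ∀ w, (p.2 w : I) = g w := by
          rintro _ rfl w
          rfl
        funext w
        exact (key _ hgg.symm w).symm)
    rw [← Cardinal.power_def, Cardinal.mk_out, hI, Cardinal.mk_sigma] at h1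
    refine h1.trans ((Cardinal.sum_le_sum _ (fun _ => κ) fun i => ?_).trans ?_)
    · rw [← Cardinal.power_def, Cardinal.mk_out]
      have h2 : #(Set.Iio i) < κ := mk_Iio_ord_toType_lt i
      calc #(Set.Iio i) ^ c ≤ (2 ^ #(Set.Iio i)) ^ c :=
            Cardinal.power_le_power_right (Cardinal.cantor _).le
        _ = 2 ^ (#(Set.Iio i) * c) := (Cardinal.power_mul).symm
        _ ≤ κ := h _ (Cardinal.mul_lt_of_lt hκ.aleph0_le h2 hc)
    · rw [Cardinal.sum_const', hI, Cardinal.mul_eq_self hκ.aleph0_le]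
  · conv_lhs => rw [← Cardinal.power_one (a := κ)]
    exact Cardinal.le_powerlt κ (Cardinal.one_lt_aleph0.trans_le hκ.aleph0_le)

theorem GCH.powerlt_self (hGCH : GCH.{u}) {κ : Cardinal.{u}} (hκ : κ.IsRegular) : κ ^< κ = κ := by
  refine hκ.powerlt_self fun c hc => ?_
  rcases lt_or_ge c ℵ₀ with h | h
  · exact (Cardinal.power_lt_aleph0 (Cardinal.natCast_lt_aleph0 (n := 2)) h).le.trans hκ.aleph0_le
  · rw [hGCH c h]
    exact Order.succ_le_of_lt hc

theorem gch_of_powerlt_self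
    (h : ∀ κ : Cardinal.{u}, ℵ₀ < κ → κ.IsRegular → κ ^< κ = κ) : GCH.{u} := by
  intro c hc
  refine le_antisymm ?_ (Order.succ_le_of_lt (Cardinal.cantor c))
  have h1 := h (Order.succ c) (Order.lt_succ_of_le hc) (Cardinal.isRegular_succ hc)
  calc 2 ^ c ≤ Order.succ c ^ c := Cardinal.power_le_power_right
        ((Cardinal.natCast_lt_aleph0 (n := 2)).le.trans (hc.trans (Order.le_succ c)))
    _ ≤ Order.succ c ^< Order.succ c := Cardinal.le_powerlt _ (Order.lt_succ c)
    _ = Order.succ c := h1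

theorem IsSaturatedRealClosedField.powerlt_self {F : Type u} [Field F]
    (h : IsSaturatedRealClosedField F) : #F ^< #F = #F := by
  have := h.1
  let := IsRealClosed.linearOrder F
  have := IsRealClosed.isStrictOrderedRing F
  have hF := h.isEtaOrder
  exact (hF.isRegular (Cardinal.infinite_iff.1 inferInstance)).powerlt_self
    fun c hc => hF.two_power_le hc

/-! ### Existence of saturated models -/

namespace FirstOrder.Language

variable {L : Language.{0, 0}}

/-- A set of formulas in the variables `C` is satisfiable with the theory `T` if all its formulas
hold under some assignment of the variables in some nonempty model of `T`. -/
def Theory.SatisfiesFormulas (T : L.Theory) {C : Type u} (Γ : Set (L.Formula C)) : Prop :=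
  ∃ (N : Type u) (_ : L.Structure N) (_ : Nonempty N) (v : C → N), N ⊨ T ∧ ∀ φ ∈ Γ, φ.Realize v

/-- Compactness, for formulas with an arbitrary set of variables: an ultraproduct of the assignments
for the finite subsets. -/
theorem Theory.satisfiesFormulas_of_finite (T : L.Theory) {C : Type u} (Γ : Set (L.Formula C))
    (h : ∀ q ⊆ Γ, q.Finite → T.SatisfiesFormulas q) : T.SatisfiesFormulas Γ := by
  classical
  have h' : ∀ q : Finset Γ, T.SatisfiesFormulas (Subtype.val '' (q : Set Γ)) := fun q =>
    h _ (by rintro _ ⟨φ, -, rfl⟩; exact φ.2) (q.finite_toSet.image _)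
  choose N _ _ v hT hv using h'
  let U : Ultrafilter (Finset Γ) := Ultrafilter.of Filter.atTop
  refine ⟨(U : Filter (Finset Γ)).Product N, inferInstance, Ultraproduct.Product.instNonempty,
    fun c => ((fun q => v q c : ∀ q, N q) : (U : Filter (Finset Γ)).Product N), ?_, fun φ hφ => ?_⟩
  · refine T.model_iff.2 fun φ hφ => ?_
    rw [Ultraproduct.sentence_realize]
    exact Filter.Eventually.of_forall fun q => (hT q).realize_of_mem φ hφ
  · refine (Ultraproduct.realize_formula_cast φ fun c q => v q c).2 (Ultrafilter.of_le _ ?_)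
    filter_upwards [Filter.eventually_ge_atTop {⟨φ, hφ⟩}] with q hq
    exact hv q φ ⟨⟨φ, hφ⟩, hq (Finset.mem_singleton_self _), rfl⟩

/-- Let sets of formulas `P c` be given for the members `c` of a well-ordered set of variables, such
that the formulas in `P c` depend on the variables up to `c` only. There is an assignment `v` in a
model of `T` that satisfies `P c` whenever, with the other variables fixed, `P c` is finitely
satisfiable in the variable `c`. By recursion, `P c` is accepted if it is consistent with the sets
accepted before; all accepted sets together are satisfiable by compactness. -/
theorem Theory.exists_generic_assignment (T : L.Theory) {C : Type u} [LinearOrder C]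
    [WellFoundedLT C] (hT : T.SatisfiesFormulas (∅ : Set (L.Formula C))) (P : C → Set (L.Formula C))
    (hP : ∀ c, ∀ φ ∈ P c, ∀ (N : Type u) [L.Structure N] (v w : C → N), (∀ d ≤ c, v d = w d) →
      φ.Realize v → φ.Realize w) :
    ∃ (N : Type u) (_ : L.Structure N) (_ : Nonempty N) (v : C → N), N ⊨ T ∧
      ∀ c, (∀ q ⊆ P c, q.Finite → ∃ x, ∀ φ ∈ q, φ.Realize (Function.update v c x)) →
        ∀ φ ∈ P c, φ.Realize v := by
  classical
  let Good : C → Prop := (wellFounded_lt (α := C)).fix fun c G =>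
    T.SatisfiesFormulas (P c ∪ {φ | ∃ d, ∃ h : d < c, G d h ∧ φ ∈ P d})
  have hGood : ∀ c, Good c ↔
      T.SatisfiesFormulas (P c ∪ {φ | ∃ d, d < c ∧ Good d ∧ φ ∈ P d}) := fun c => by
    refine iff_of_eq (((wellFounded_lt (α := C)).fix_eq _ c).trans ?_)
    congr 2
    ext φ
    exact ⟨fun ⟨d, h1, h2⟩ => ⟨d, h1, h2⟩, fun ⟨d, h1, h2⟩ => ⟨d, h1, h2⟩⟩
  obtain ⟨N, _, hN, v, hNT, hv⟩ := T.satisfiesFormulas_of_finite {φ | ∃ d, Good d ∧ φ ∈ P d} (by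
    intro q hq hfin
    rcases q.eq_empty_or_nonempty with rfl | hne
    · exact hT
    choose r hr1 hr2 using fun φ : q => hq φ.2
    have := hfin.fintype
    have := hne.to_subtype
    obtain ⟨φ₀, -, hmax⟩ := Finset.exists_max_image Finset.univ r Finset.univ_nonempty
    obtain ⟨N, _, hN, v, hNT, hv⟩ := (hGood _).1 (hr1 φ₀)
    refine ⟨N, inferInstance, hN, v, hNT, fun φ hφ => hv φ ?_⟩
    rcases (hmax ⟨φ, hφ⟩ (Finset.mem_univ _)).eq_or_lt with h | h
    · exact Or.inl (h ▸ hr2 ⟨φ, hφ⟩)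
    · exact Or.inr ⟨_, h, hr1 _, hr2 ⟨φ, hφ⟩⟩)
  refine ⟨N, inferInstance, hN, v, hNT, fun c hc φ hφ => hv φ ⟨c, (hGood c).2 ?_, hφ⟩⟩
  refine T.satisfiesFormulas_of_finite _ fun q hq hfin => ?_
  obtain ⟨x, hx⟩ := hc (q ∩ P c) Set.inter_subset_right (hfin.subset Set.inter_subset_left)
  refine ⟨N, inferInstance, hN, Function.update v c x, hNT, fun φ hφ => ?_⟩
  rcases hq hφ with h | ⟨d, hdc, hd, hφd⟩
  · exact hx φ ⟨hφ, h⟩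
  · refine hP d φ hφd N v _ (fun e hed => ?_) (hv φ ⟨d, hd, hφd⟩)
    rw [Function.update_of_ne (hed.trans_lt hdc).ne]

theorem card_formula_le {α : Type u} (hL : L.card ≤ ℵ₀) : #(L.Formula α) ≤ max ℵ₀ #α := by
  have h1 : #(L.Formula α) ≤ #(Σ n, L.BoundedFormula α n) :=
    Cardinal.mk_le_of_injective (f := fun φ => (⟨0, φ⟩ : Σ n, L.BoundedFormula α n))
      fun φ ψ h => by simpa using h
  refine h1.trans (BoundedFormula.card_le.trans ?_)
  rw [Cardinal.lift_uzero]
  refine max_le (le_max_left _ _) ((add_le_add le_rfl (Cardinal.lift_le.2 hL)).trans ?_)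
  rw [Cardinal.lift_aleph0, max_comm]
  exact (Cardinal.add_le_max _ _).trans (by simp)

/-- The shape of a name for an element that realizes a type over fewer than `κ` parameters: the
number of the parameters, given as an initial segment of `κ`, and the set of formulas. -/
abbrev TypeShape (L : Language.{0, 0}) (κ : Cardinal.{u}) : Type u :=
  Σ o : κ.ord.ToType, Set (L.Formula (Set.Iio o ⊕ Unit))

/-- Names for the elements of a saturated model: a name consists of a set of formulas in one free
variable with fewer than `κ` parameters, and of names for these parameters. -/
abbrev TypeName (L : Language.{0, 0}) (κ : Cardinal.{u}) : Type u :=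
  WType fun s : TypeShape L κ => Set.Iio s.1

namespace TypeName

variable {κ : Cardinal.{u}}

theorem card_le (hL : L.card ≤ ℵ₀) (hκ : ℵ₀ < κ) (hpow : κ ^< κ = κ) : #(TypeName L κ) ≤ κ := by
  have hle : ∀ c < κ, κ ^ c ≤ κ := fun c hc => (Cardinal.le_powerlt κ hc).trans hpow.le
  refine WType.cardinalMk_le_of_le ?_
  refine (Cardinal.sum_le_sum _ (fun _ => κ) fun s : TypeShape L κ =>
    hle _ (mk_Iio_ord_toType_lt s.1)).trans ?_
  rw [Cardinal.sum_const']
  refine (mul_le_mul_left (?_ : #(TypeShape L κ) ≤ κ) κ).trans (Cardinal.mul_eq_self hκ.le).le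
  rw [TypeShape, Cardinal.mk_sigma]
  refine (Cardinal.sum_le_sum _ (fun _ => κ) fun o => ?_).trans ?_
  · have h1 : #(L.Formula (Set.Iio o ⊕ Unit)) < κ := by
      refine (card_formula_le hL).trans_lt (max_lt hκ ?_)
      rw [Cardinal.mk_sum]
      refine Cardinal.add_lt_of_lt hκ.le ?_ ?_
      · simpa using mk_Iio_ord_toType_lt o
      · simpa using Cardinal.one_lt_aleph0.trans hκ
    rw [Cardinal.mk_set]
    exact (Cardinal.power_le_power_right
      ((Cardinal.natCast_lt_aleph0 (n := 2)).le.trans hκ.le)).trans (hle _ h1)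
  · rw [Cardinal.sum_const', Cardinal.mk_ord_toType, Cardinal.mul_eq_self hκ.le]

/-- A name is a child of another one if it names one of its parameters. -/
def IsChild (c d : TypeName L κ) : Prop :=
  ∃ s f i, d = WType.mk s f ∧ c = f i

theorem wellFounded_isChild : WellFounded (IsChild (L := L) (κ := κ)) := by
  refine ⟨fun d => ?_⟩
  induction d with
  | mk s f ih =>
  refine ⟨_, ?_⟩
  rintro c ⟨s', f', i, h, rfl⟩
  obtain ⟨rfl, h⟩ := WType.mk.inj h
  obtain rfl := eq_of_heq h
  exact ih i

/-- The formulas that a name asks for, with the names themselves as variables. -/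
def formulas : TypeName L κ → Set (L.Formula (TypeName L κ))
  | WType.mk s f => (fun φ => φ.relabel (Sum.elim f fun _ => WType.mk s f)) '' s.2

end TypeName

theorem exists_Iio_ord_toType_equiv {κ : Cardinal.{u}} {B : Type u} (hB : #B < κ) :
    ∃ o : κ.ord.ToType, Nonempty (Set.Iio o ≃ B) := by
  have hlt : (#B).ord < Ordinal.type (α := κ.ord.ToType) (· < ·) := by
    rw [Ordinal.type_toType]
    exact Cardinal.ord_lt_ord.2 hB
  obtain ⟨o, ho⟩ := Ordinal.typein_surj (α := κ.ord.ToType) (· < ·) hlt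
  refine ⟨o, Cardinal.eq.1 ?_⟩
  have := congrArg Ordinal.card ho
  rwa [Ordinal.card_typein, Cardinal.card_ord] at this

/-- Some model of `T` has an assignment of the names whose range realizes all small types over it.
-/
theorem Theory.exists_model_realizing_names (T : L.Theory) {κ : Cardinal.{u}}
    (hT : T.SatisfiesFormulas (∅ : Set (L.Formula (TypeName L κ)))) :
    ∃ (N : Type u) (_ : L.Structure N) (_ : Nonempty N) (v : TypeName L κ → N), N ⊨ T ∧
      ∀ (B : Type u) (a : B → N), #B < κ → (∀ b, a b ∈ Set.range v) →
        ∀ p : Set (L.Formula (B ⊕ Unit)),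
          (∀ q ⊆ p, q.Finite → ∃ x, ∀ φ ∈ q, φ.Realize (Sum.elim a fun _ => x)) →
          ∃ x ∈ Set.range v, ∀ φ ∈ p, φ.Realize (Sum.elim a fun _ => x) := by
  classical
  have : IsWellFounded (TypeName L κ) TypeName.IsChild := ⟨TypeName.wellFounded_isChild⟩
  obtain ⟨lt, hlt, _⟩ := IsWellFounded.exists_well_order_ge (TypeName.IsChild (L := L) (κ := κ))
  let := linearOrderOfSTO lt
  have : WellFoundedLT (TypeName L κ) := ⟨IsWellFounded.wf (r := lt)⟩
  have hchild : ∀ s (f : Set.Iio s.1 → TypeName L κ) i, f i < WType.mk s f := fun s f i =>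
    hlt _ _ ⟨s, f, i, rfl, rfl⟩
  obtain ⟨N, _, hN, v, hNT, hv⟩ := T.exists_generic_assignment hT TypeName.formulas (by
    rintro ⟨s, f⟩ _ ⟨φ, hφ, rfl⟩ N _ v w hvw h
    rw [Formula.realize_relabel] at h ⊢
    convert h using 1
    funext i
    rcases i with i | i
    · exact (hvw _ (hchild s f i).le).symm
    · exact (hvw _ le_rfl).symm)
  refine ⟨N, inferInstance, hN, v, hNT, fun B a hB ha p hp => ?_⟩
  obtain ⟨o, ⟨e⟩⟩ := exists_Iio_ord_toType_equiv hB
  choose a' ha' using ha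
  let s : TypeShape L κ := ⟨o, (fun φ => φ.relabel (Sum.map e.symm id)) '' p⟩
  let c : TypeName L κ := WType.mk s (a' ∘ e)
  have hreal : ∀ (φ : L.Formula (B ⊕ Unit)) (w : TypeName L κ → N), (∀ b, w (a' b) = a b) →
      (((φ.relabel (Sum.map e.symm id)).relabel (Sum.elim (a' ∘ e) fun _ => c)).Realize w ↔
        φ.Realize (Sum.elim a fun _ => w c)) := by
    intro φ w hw
    rw [Formula.realize_relabel, Formula.realize_relabel]
    have : (w ∘ (Sum.elim (a' ∘ e) fun _ : Unit => c)) ∘ Sum.map e.symm id =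
        Sum.elim a fun _ => w c := by
      funext i
      rcases i with i | i
      · simp [hw]
      · rfl
    rw [this]
  have hne : ∀ b, a' b ≠ c := fun b => by
    have := hchild s (a' ∘ e) (e.symm b)
    exact fun hb => this.ne ((congrArg a' (e.apply_symm_apply b)).trans hb)
  have key := hv c (by
    intro q hq hfin
    have hex : ∀ φ : q, ∃ ψ ∈ p,
        (ψ.relabel (Sum.map e.symm id)).relabel (Sum.elim (a' ∘ e) fun _ => c) = φ := by
      rintro ⟨φ, hφ⟩
      obtain ⟨_, ⟨ψ, hψ, rfl⟩, h⟩ := hq hφ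
      exact ⟨ψ, hψ, h⟩
    choose r hr1 hr2 using hex
    have := hfin.fintype
    obtain ⟨x, hx⟩ := hp (Set.range r) (by rintro _ ⟨φ, rfl⟩; exact hr1 φ) (Set.finite_range _)
    refine ⟨x, fun φ hφ => ?_⟩
    have h1 : φ = _ := (hr2 ⟨φ, hφ⟩).symm
    rw [h1]
    refine (hreal _ _ fun b => ?_).2 ?_
    · rw [Function.update_of_ne (hne b), ha']
    · rw [Function.update_self]
      exact hx _ ⟨⟨φ, hφ⟩, rfl⟩)
  exact ⟨v c, ⟨c, rfl⟩, fun φ hφ => (hreal φ v ha').1 (key _ ⟨_, ⟨φ, hφ, rfl⟩, rfl⟩)⟩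

/-- A theory in a countable language whose models are infinite has, for each uncountable `κ` with
`κ ^< κ = κ`, a `κ`-saturated model of cardinality `κ`: the range of the assignment of the names, an
elementary substructure by the Tarski–Vaught test. -/
theorem Theory.exists_saturated_model (T : L.Theory) (hL : L.card ≤ ℵ₀)
    (hT : ∃ (N : Type u) (_ : L.Structure N), Nonempty N ∧ N ⊨ T)
    (hinf : ∀ (N : Type u) [L.Structure N] [Nonempty N], N ⊨ T → Infinite N)
    {κ : Cardinal.{u}} (hκ : ℵ₀ < κ) (hpow : κ ^< κ = κ) :
    ∃ (M : Type u) (_ : L.Structure M), Nonempty M ∧ M ⊨ T ∧ #M = κ ∧ IsSaturated L M := by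
  obtain ⟨N₀, _, hN₀, hN₀T⟩ := hT
  obtain ⟨N, _, hN, v, hNT, hv⟩ := T.exists_model_realizing_names (κ := κ)
    ⟨N₀, inferInstance, hN₀, fun _ => Classical.arbitrary N₀, hN₀T, fun φ hφ => absurd hφ (by simp)⟩
  have hfin : ∀ n : ℕ, #(ULift.{u} (Fin n)) < κ := fun n => by
    simpa using (Cardinal.natCast_lt_aleph0 (n := n)).trans hκ
  let S : L.Substructure N :=
    { carrier := Set.range v
      fun_mem := fun {n} f x hx => by
        obtain ⟨y, hy, hyp⟩ := hv (ULift.{u} (Fin n)) (fun i => x i.down) (hfin n)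
          (fun i => hx i.down)
          {(Term.var (Sum.inr ())).equal (Term.func f fun i => Term.var (Sum.inl (ULift.up i)))} (by
            intro q hq _
            refine ⟨Structure.funMap f x, fun φ hφ => ?_⟩
            rw [hq hφ, Formula.realize_equal]
            simp)
        have := hyp _ rfl
        rw [Formula.realize_equal] at this
        simp only [Term.realize_var, Term.realize_func, Sum.elim_inr, Sum.elim_inl] at this
        rwa [← this] }
  -- The Tarski–Vaught test: a witness is a realization of the type of a single formula.
  let M : L.ElementarySubstructure N := S.toElementarySubstructure (by
    intro n φ x a ha
    let ψ : L.Formula (ULift.{u} (Fin n) ⊕ Unit) := φ.toFormula.relabel (Sum.elim Empty.elim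
      (Fin.lastCases (Sum.inr ()) fun i => Sum.inl (ULift.up i)))
    have hψ : ∀ y, ψ.Realize (Sum.elim (fun i => (x i.down : N)) fun _ => y) ↔
        φ.Realize default (Fin.snoc ((↑) ∘ x) y : _ → N) := fun y => by
      rw [Formula.realize_relabel, BoundedFormula.realize_toFormula]
      have : ((Sum.elim (fun i : ULift.{u} (Fin n) => (x i.down : N)) (fun _ : Unit => y) ∘
          Sum.elim Empty.elim (Fin.lastCases (Sum.inr ()) fun i => Sum.inl (ULift.up i))) ∘
          Sum.inr) = (Fin.snoc ((↑) ∘ x) y : _ → N) := by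
        funext i
        induction i using Fin.lastCases <;> simp
      rw [this]
      exact iff_of_eq (congrArg (fun w => φ.Realize w _) (Subsingleton.elim _ _))
    obtain ⟨y, hy, hyp⟩ := hv (ULift.{u} (Fin n)) (fun i => x i.down) (hfin n)
      (fun i => (x i.down).2) {ψ} (fun q hq _ => ⟨a, fun θ hθ => hq hθ ▸ (hψ a).2 ha⟩)
    exact ⟨⟨y, hy⟩, (hψ y).1 (hyp _ rfl)⟩)
  have hMT : M ⊨ T := (M.theory_model_iff T).2 hNT
  have hMne : Nonempty M := by
    obtain ⟨y, hy, -⟩ := hv (ULift.{u} (Fin 0)) (fun i => i.down.elim0) (hfin 0)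
      (fun i => i.down.elim0) ∅ fun q hq _ => ⟨Classical.arbitrary N, fun φ hφ => absurd (hq hφ) id⟩
    exact ⟨⟨y, hy⟩⟩
  have hsat : IsKappaSaturated L M κ := by
    intro A hA p hp
    have hmap : ∀ (φ : L.Formula (A ⊕ Unit)) (y : M),
        φ.Realize (Sum.elim (fun a : A => ((a : M) : N)) fun _ => (y : N)) ↔
          φ.Realize (Sum.elim (fun a : A => (a : M)) fun _ => y) := fun φ y => by
      rw [← M.subtype.map_formula]
      refine iff_of_eq (congrArg φ.Realize ?_)
      funext i
      rcases i with i | i <;> rfl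
    obtain ⟨y, hy, hyp⟩ := hv A (fun a => ((a : M) : N)) hA (fun a => a.1.2) p
      fun q hq hfin => by
        obtain ⟨y, hy⟩ := hp q hq hfin
        exact ⟨y, fun φ hφ => (hmap φ y).2 (hy φ hφ)⟩
    exact ⟨⟨y, hy⟩, fun φ hφ => (hmap φ ⟨y, hy⟩).1 (hyp φ hφ)⟩
  have hMinf := hinf M hMT
  have hle : #M ≤ κ := (Cardinal.mk_range_le (f := v)).trans (TypeName.card_le hL hκ hpow)
  -- Otherwise the type of an element different from all elements of `M` would be realized in `M`.
  have hge : κ ≤ #M := by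
    by_contra! hlt
    let θ : ↥(Set.univ : Set M) → L.Formula ((Set.univ : Set M) ⊕ Unit) := fun m =>
      ∼((Term.var (Sum.inr ())).equal (Term.var (Sum.inl m)))
    have hθ : ∀ m x, (θ m).Realize (Sum.elim (fun a : (Set.univ : Set M) => (a : M)) fun _ => x) ↔
        x ≠ m := fun m x => by
      rw [Formula.realize_not, Formula.realize_equal]
      rfl
    obtain ⟨x, hx⟩ := hsat Set.univ (by rwa [Cardinal.mk_univ]) (Set.range θ) fun q hq hfin => by
      choose r hr using fun φ : q => hq φ.2
      have := hfin.to_subtype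
      obtain ⟨x, hx⟩ := (Set.finite_range fun φ => (r φ : M)).exists_notMem
      refine ⟨x, fun φ hφ => ?_⟩
      have h1 := hr ⟨φ, hφ⟩
      simp only at h1
      rw [← h1, hθ]
      rintro rfl
      exact hx ⟨_, rfl⟩
    exact (hθ ⟨x, trivial⟩ x).1 (hx _ ⟨_, rfl⟩) rfl
  have hcard := le_antisymm hle hge
  refine ⟨M, inferInstance, hMne, hMT, hcard, ?_⟩
  rw [IsSaturated, hcard]
  exact hsat

end FirstOrder.Language

/-! ### The first-order theory of real closed fields -/

section

open Polynomial

/-- In a field where sums of two squares are squares and `-1` is not a square, the axioms of real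
closed fields need only be checked for monic polynomials. -/
theorem IsRealClosed.of_monic {K : Type*} [Field K]
    (hsq : ∀ x : K, ∃ y, x = y * y ∨ -x = y * y)
    (hadd : ∀ x y : K, ∃ z, x * x + y * y = z * z)
    (hneg : ∀ x : K, x * x + 1 ≠ 0)
    (hroot : ∀ p : K[X], p.Monic → Odd p.natDegree → ∃ x, p.eval x = 0) :
    IsRealClosed K where
  one_add_ne_zero {s} hs := by
    have h : IsSquare s := by
      induction hs with
      | zero => exact ⟨0, by simp⟩
      | sq_add a _ ih =>
        obtain ⟨b, rfl⟩ := ih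
        exact hadd a b
    obtain ⟨x, rfl⟩ := h
    rw [add_comm]
    exact hneg x
  isSquare_or_isSquare_neg x := by
    obtain ⟨y, h | h⟩ := hsq x
    exacts [.inl ⟨y, h⟩, .inr ⟨y, h⟩]
  exists_isRoot_of_odd_natDegree {f} hf := by
    have hf0 : f ≠ 0 := by rintro rfl; simp at hf
    have hm : (f * C f.leadingCoeff⁻¹).Monic := monic_mul_leadingCoeff_inv hf0
    obtain ⟨x, hx⟩ := hroot _ hm (by
      rwa [natDegree_mul_leadingCoeff_inv f hf0])
    exact ⟨x, by simpa [hf0] using hx⟩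

theorem Real.exists_eval_eq_zero_of_odd_natDegree {p : ℝ[X]} (hp : p.Monic)
    (hodd : Odd p.natDegree) : ∃ x, p.eval x = 0 := by
  have hpos : 0 < p.natDegree := hodd.pos
  have htop := p.tendsto_atTop_of_leadingCoeff_nonneg (natDegree_pos_iff_degree_pos.1 hpos)
    (by rw [hp.leadingCoeff]; exact zero_le_one)
  have hdeg : (p.comp (-X)).natDegree = p.natDegree := by simp [natDegree_comp]
  have hlead : (p.comp (-X)).leadingCoeff = -1 := by
    rw [leadingCoeff_comp (by simp), hp.leadingCoeff]
    simp [hodd.neg_one_pow]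
  have hbot := (p.comp (-X)).tendsto_atBot_of_leadingCoeff_nonpos
    (natDegree_pos_iff_degree_pos.1 (hdeg ▸ hpos)) (by rw [hlead]; norm_num)
  obtain ⟨a, ha⟩ := (hbot.eventually_le_atBot 0).exists
  obtain ⟨b, hb⟩ := (htop.eventually_ge_atTop 0).exists
  exact mem_range_of_exists_le_of_exists_ge p.continuous ⟨-a, by simpa using ha⟩ ⟨b, hb⟩

/-- The real numbers, lifted to an arbitrary universe, are a real closed field. -/
theorem isRealClosed_uLift_real : IsRealClosed (ULift.{u} ℝ) := by
  have e : ULift.{u} ℝ ≃+* ℝ := ULift.ringEquiv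
  refine .of_monic (fun x ↦ ?_) (fun x y ↦ ?_) (fun x h ↦ ?_) (fun p hp hodd ↦ ?_)
  · refine ⟨e.symm √|e x|, ?_⟩
    rw [← map_mul, Real.mul_self_sqrt (abs_nonneg _), e.eq_symm_apply, e.eq_symm_apply, map_neg]
    rcases abs_choice (e x) with h | h
    exacts [.inl h.symm, .inr h.symm]
  · refine ⟨e.symm √(e x * e x + e y * e y), ?_⟩
    rw [← map_mul, Real.mul_self_sqrt (add_nonneg (mul_self_nonneg _) (mul_self_nonneg _))]
    simp
  · have := congrArg e h
    simp only [map_add, map_mul, map_one, map_zero] at this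
    nlinarith [mul_self_nonneg (e x)]
  · obtain ⟨x, hx⟩ := Real.exists_eval_eq_zero_of_odd_natDegree (hp.map e.toRingHom)
      (by rwa [hp.natDegree_map])
    refine ⟨e.symm x, e.injective ?_⟩
    have := p.eval₂_at_apply e.toRingHom (e.symm x)
    rw [← eval_map] at this
    have h0 : (p.map e.toRingHom).eval (e.toRingHom (e.symm x)) = 0 := by simpa using hx
    exact (this.symm.trans h0).trans (map_zero e).symm

end

namespace FirstOrder

namespace Field

open FirstOrder.Language FirstOrder.Ring Structure BoundedFormula Polynomial

/-- Every element or its negative is a square. -/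
noncomputable def isSquareOrNeg : Language.ring.Sentence :=
  ∀' ∃' ((&0 =' (&1 * &1)) ⊔ ((-&0) =' (&1 * &1)))

/-- A sum of two squares is a square. -/
noncomputable def sumTwoSquares : Language.ring.Sentence :=
  ∀' ∀' ∃' ((&0 * &0 + &1 * &1) =' (&2 * &2))

/-- The element `-1` is not a square. -/
noncomputable def negOneNotSquare : Language.ring.Sentence :=
  ∀' ∼((&0 * &0 + 1) =' (0 : Language.ring.Term _))

/-- The theory of real closed fields in the language of rings. Since sums of two squares are squares,
the condition that `-1` is not a sum of squares reduces to `-1` not being a square. -/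
noncomputable def _root_.FirstOrder.Language.Theory.RCF : Language.ring.Theory :=
  Theory.field ∪ ({isSquareOrNeg, sumTwoSquares, negOneNotSquare} ∪
    genericMonicPolyHasRoot '' {n | Odd n})

theorem model_RCF_iff {K : Type*} [Field K] [CompatibleRing K] :
    K ⊨ Theory.RCF ↔ IsRealClosed K := by
  have h1 : K ⊨ isSquareOrNeg ↔ ∀ x : K, ∃ y, x = y * y ∨ -x = y * y := by
    simp [isSquareOrNeg, Sentence.Realize, Formula.Realize, Fin.snoc]
  have h2 : K ⊨ sumTwoSquares ↔ ∀ x y : K, ∃ z, x * x + y * y = z * z := by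
    simp [sumTwoSquares, Sentence.Realize, Formula.Realize, Fin.snoc]
  have h3 : K ⊨ negOneNotSquare ↔ ∀ x : K, x * x + 1 ≠ 0 := by
    simp [negOneNotSquare, Sentence.Realize, Formula.Realize, Fin.snoc]
  have h4 : (∀ φ ∈ genericMonicPolyHasRoot '' {n | Odd n}, K ⊨ φ) ↔
      ∀ p : K[X], p.Monic → Odd p.natDegree → ∃ x, p.eval x = 0 := by
    simp only [Set.forall_mem_image, Set.mem_ofPred_eq, realize_genericMonicPolyHasRoot,
      Subtype.forall]
    exact ⟨fun h p hp hodd ↦ h hodd p ⟨hp, rfl⟩, fun h n hn p hp ↦ h p hp.1 (hp.2 ▸ hn)⟩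
  have hfield : K ⊨ Theory.field := inferInstance
  rw [Theory.RCF, Theory.model_union_iff, Theory.model_union_iff]
  simp only [hfield, true_and, Theory.model_iff, h4]
  simp only [Set.mem_insert_iff, Set.mem_singleton_iff, forall_eq_or_imp, forall_eq, h1, h2, h3]
  refine ⟨fun h ↦ .of_monic h.1.1 h.1.2.1 h.1.2.2 h.2, fun h ↦ ⟨⟨fun x ↦ ?_, fun x y ↦ ?_,
    fun x hx ↦ ?_⟩, fun p _ hodd ↦ IsRealClosed.exists_isRoot_of_odd_natDegree hodd⟩⟩
  · rcases IsRealClosed.isSquare_or_isSquare_neg x with ⟨y, hy⟩ | ⟨y, hy⟩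
    exacts [⟨y, .inl hy⟩, ⟨y, .inr hy⟩]
  · exact IsRealClosed.isSquare_add (.mul_self x) (.mul_self y)
  · exact IsSemireal.one_add_ne_zero (IsSumSq.mul_self x) (by rwa [add_comm])

theorem compatibleRingOfRing_toStructure {K : Type*} [Field K] [S : CompatibleRing K] :
    (compatibleRingOfRing K).toStructure = S.toStructure := by
  refine Structure.ext ?_ ?_
  · funext n f x
    cases f
    · exact (S.funMap_add x).symm
    · exact (S.funMap_mul x).symm
    · exact (S.funMap_neg x).symm
    · exact (S.funMap_zero x).symm
    · exact (S.funMap_one x).symm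
  · funext n r
    cases r

end Field

end FirstOrder

open FirstOrder Language Field in
theorem exists_isSaturatedRealClosedField {κ : Cardinal.{u}} (hκ : ℵ₀ < κ)
    (hpow : κ ^< κ = κ) :
    ∃ (F : Type u) (_ : _root_.Field F), #F = κ ∧ IsSaturatedRealClosedField F := by
  have hfield {N : Type u} [Language.ring.Structure N] (hN : N ⊨ Theory.RCF) :
      Theory.field.Model N := Theory.Model.mono hN Set.subset_union_left
  have hinf (N : Type u) [Language.ring.Structure N] [Nonempty N] (hN : N ⊨ Theory.RCF) :
      Infinite N := by
    have := hfield hN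
    let := fieldOfModelField N
    let := compatibleRingOfModelField N
    have : IsRealClosed N := model_RCF_iff.1 hN
    let := IsRealClosed.linearOrder N
    have := IsRealClosed.isStrictOrderedRing N
    exact CharZero.infinite N
  have hbase : ∃ (N : Type u) (_ : Language.ring.Structure N), Nonempty N ∧ N ⊨ Theory.RCF := by
    let := Ring.compatibleRingOfRing (ULift.{u} ℝ)
    exact ⟨ULift.{u} ℝ, inferInstance, inferInstance, model_RCF_iff.2 isRealClosed_uLift_real⟩
  obtain ⟨M, _, _, hM, hcard, hsat⟩ := Theory.exists_saturated_model Theory.RCF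
    (by simp) hbase hinf hκ hpow
  have := hfield hM
  let := fieldOfModelField M
  let := compatibleRingOfModelField M
  refine ⟨M, inferInstance, hcard, model_RCF_iff.1 hM, ?_⟩
  rw [compatibleRingOfRing_toStructure]
  exact hsat

/-! ### The categoricity theorem -/

theorem IsSaturatedRealClosedField.nonempty_ringEquiv {F K : Type u} [Field F] [Field K]
    (hF : IsSaturatedRealClosedField F) (hK : IsSaturatedRealClosedField K) (hκ : ℵ₀ < #F)
    (hreg : (#F).IsRegular) (hFK : #K = #F) : Nonempty (F ≃+* K) := by
  have := hF.1
  have := hK.1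
  let := IsRealClosed.linearOrder F
  let := IsRealClosed.linearOrder K
  have := IsRealClosed.isStrictOrderedRing F
  have := IsRealClosed.isStrictOrderedRing K
  exact nonempty_ringEquiv_of_isEtaOrder hκ hreg hF.isEtaOrder (hFK ▸ hK.isEtaOrder) rfl hFK

theorem mainTheorem2 :
    (GCH.{u} ↔
      ∀ κ : Cardinal.{u}, ℵ₀ < κ → κ.IsRegular →
        (∃ (F : Type u) (_ : Field F), #F = κ ∧ IsSaturatedRealClosedField F) ∧
        (∀ (F K : Type u) [Field F] [Field K],
          #F = κ → IsSaturatedRealClosedField F → #K = κ → IsSaturatedRealClosedField K →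
          Nonempty (F ≃+* K))) ∧
    (∀ κ : Cardinal.{u}, ℵ₀ < κ →
      (∃ (F : Type u) (_ : Field F), #F = κ ∧ IsSaturatedRealClosedField F) →
      κ ^< κ = κ) := by
  have hpow : ∀ κ : Cardinal.{u},
      (∃ (F : Type u) (_ : Field F), #F = κ ∧ IsSaturatedRealClosedField F) → κ ^< κ = κ := by
    rintro _ ⟨F, _, rfl, hF⟩
    exact hF.powerlt_self
  refine ⟨⟨fun hGCH κ hκ hreg ↦ ⟨exists_isSaturatedRealClosedField hκ (hGCH.powerlt_self hreg),
    fun F K _ _ hFκ hF hKκ hK ↦ ?_⟩, fun h ↦ gch_of_powerlt_self fun κ hκ hreg ↦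
      hpow κ (h κ hκ hreg).1⟩, fun κ _ ↦ hpow κ⟩
  subst hFκ
  exact hF.nonempty_ringEquiv hK hκ hreg hKκ
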